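/- **Theorem 1.1.** Let $n\ge 1$ and let $$B_{n+1}=\mathrm{gp}\langle a_1,\dots,a_n \mid a_{i+1}a_ia_{i+1}=a_ia_{i+1}a_i\ (1\le i\le n-1),\ a_ka_s=a_sa_k\ (k-s>1)\rangle$$ be the braid group. Put $\Lambda_i=a_ia_{i-1}\cdots a_1$ and $\Delta=\Lambda_1\Lambda_2\cdots\Lambda_n$. Consider the alphabet $X=\{a_1,\dots,a_n,\Delta,\Delta^{-1}\}$ (the Artin–Garside generators), ordered by $\Delta^{-1}<\Delta<a_1<\dots<a_n$, and order the words in $X$ by deg-lex: first by length, then lexicographically. For $j\le i+1$ write $a_{ij}=a_ia_{i-1}\cdots a_j$ (so $a_{ii}=a_i$ and $a_{i\,i+1}=1$). By $V(j,i)$, $W(j,i)$ we mean arbitrary words in the letters $a_j,\dots,a_i$ only (so $V(i+1,i)=1$). $V^{(s)}$ denotes the word obtained from $V$ by adding $s$ to all indices, and $V'=V^{(1)}$. Let $S$ be the following set of relations: 1. (1.1) $a_{i+1}a_iV(1,i-1)W(j,i)a_{i+1\,j}=a_ia_{i+1}a_iV(1,i-1)a_{ij}W(j,i)'$ for $1\le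 i\le n-1$, $1\le j\le i+1$, where $W(j,i)$ is either empty or begins with $a_i$; 2. (1.2) $a_sa_m=a_ma_s$ for $s-m\ge 2$; 3. (1.3) $\Lambda_1V_1\Lambda_2V_2\cdots V_{n-1}\Lambda_n=\Delta V_1^{(n-1)}V_2^{(n-2)}\cdots V_{n-1}'$, where $V_i=V_i(1,i)$; 4. (1.4) $a_l\Delta=\Delta a_{n-l+1}$ for $1\le l\le n$; 5. (1.5) $a_l\Delta^{-1}=\Delta^{-1}a_{n-l+1}$ for $1\le l\le n$; 6. (1.6) $\Delta\Delta^{-1}=1$ and $\Delta^{-1}\Delta=1$. Then $S$ is a Gröbner–Shirshov basis of $B_{n+1}$ in the Artin–Garside generators. That is: (a) $S$ is a set of defining relations of $B_{n+1}$ as a monoid generated by $X$: sending the letters $a_i,\Delta,\Delta^{-1}$ to the elements of $B_{n+1}$ that they denote induces an isomorphism $\mathrm{sgp}\langle X\mid S\rangle\cong B_{n+1}$; (b) over every field $k$, the set of polynomials $u-v\in k\langle X\rangle$, with $u=v$ in $S$, is a Gröbner–Shirshov set: it consists of monic polynomials, and every composition of its elements is trivial. Here $\overline f$ is the leading word of a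 polynomial $f$. The compositions of $f,g\in S$ are $(f,g)_w=fb-ag$ with $w=\overline fb=a\overline g$, $|w|<|\overline f|+|\overline g|$, and $(f,g)_w=f-agb$ with $w=\overline f=a\overline gb$, where $a,b$ are words. A composition $(f,g)_w$ is trivial if it equals a finite sum $\sum_t\alpha_t\,c_ts_td_t$ with $\alpha_t\in k$, $s_t\in S$, words $c_t,d_t$, and $c_t\overline{s_t}d_t<w$ for all $t$. -/

import Mathlib

/-! ### Gröbner–Shirshov sets in the free associative algebra

The free associative algebra `k⟨X⟩` is realised as the monoid algebra of the free monoid on `X`,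
that is, as linear combinations of words in `X`. -/

/-- The free associative algebra `k⟨X⟩`, with its basis of words in `X`. -/
abbrev FreeAssoc (k X : Type*) [Field k] : Type _ := MonoidAlgebra k (FreeMonoid X)

/-- A word, viewed as a monomial of `k⟨X⟩`. -/
noncomputable abbrev monom (k : Type*) {X : Type*} [Field k] (u : FreeMonoid X) : FreeAssoc k X :=
  MonoidAlgebra.of k (FreeMonoid X) u

/-- The deg-lex order on words: first compare lengths, then compare words of equal length
lexicographically (from the left). -/
def DegLexLT {X : Type*} [LinearOrder X] (u v : FreeMonoid X) : Prop :=
  List.Shortlex (· < ·) u.toList v.toList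

/-- The polynomial `f` is nonzero and monic, and its leading word is `u`. -/
def MonicWithLeadingWord {k X : Type*} [Field k] [LinearOrder X]
    (f : FreeAssoc k X) (u : FreeMonoid X) : Prop :=
  f.coeff u = 1 ∧ ∀ v, f.coeff v ≠ 0 → v = u ∨ DegLexLT v u

/-- The polynomial `h` is trivial mod `(S, w)`: it is a linear combination of elements `a s b`
with `s ∈ S`, with words `a`, `b`, and with `a s̄ b < w`, where `s̄` is the leading word of `s`. -/
def TrivialMod {k X : Type*} [Field k] [LinearOrder X]
    (S : Set (FreeAssoc k X)) (w : FreeMonoid X) (h : FreeAssoc k X) : Prop :=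
  h ∈ Submodule.span k
    {p : FreeAssoc k X | ∃ s ∈ S, ∃ u a b : FreeMonoid X, MonicWithLeadingWord s u ∧
      DegLexLT (a * u * b) w ∧ p = monom k a * s * monom k b}

/-- A set `S` of monic polynomials is a Gröbner–Shirshov set if all compositions of its elements
are trivial: the compositions of intersection `f b - a g` with `w = f̄ b = a ḡ` and
`|w| < |f̄| + |ḡ|`, and the compositions of inclusion `f - a g b` with `w = f̄ = a ḡ b`. -/
structure IsGroebnerShirshov {k X : Type*} [Field k] [LinearOrder X]
    (S : Set (FreeAssoc k X)) : Prop where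
  monic : ∀ f ∈ S, ∃ u, MonicWithLeadingWord f u
  intersection : ∀ f ∈ S, ∀ g ∈ S, ∀ u v a b w : FreeMonoid X,
    MonicWithLeadingWord f u → MonicWithLeadingWord g v →
    w = u * b → w = a * v → w.length < u.length + v.length →
    TrivialMod S w (f * monom k b - monom k a * g)
  inclusion : ∀ f ∈ S, ∀ g ∈ S, ∀ u v a b w : FreeMonoid X,
    MonicWithLeadingWord f u → MonicWithLeadingWord g v →
    w = u → w = a * v * b →
    TrivialMod S w (f - monom k a * g * monom k b)

/-- The set of polynomials `u - v` corresponding to a set of semigroup relations `u = v`. -/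
def relationPolynomials (k : Type*) {X : Type*} [Field k]
    (R : FreeMonoid X → FreeMonoid X → Prop) : Set (FreeAssoc k X) :=
  {f | ∃ u v, R u v ∧ f = monom k u - monom k v}

/-! ### Index words

A positive word in `a_1, …, a_n` is written as the list of its indices. -/

/-- The index word of `a_{ij} = a_i a_{i-1} ⋯ a_j` (for `j ≤ i + 1`; empty for `j = i + 1`). -/
def descWord (i j : ℕ) : List ℕ := (List.range (i + 1 - j)).map fun t => i - t

/-- The index word of `Λ_i = a_i ⋯ a_1`. -/
def lambdaWord (i : ℕ) : List ℕ := descWord i 1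

/-- The index word of `Λ_1 Λ_2 ⋯ Λ_n`. -/
def garsideWord (n : ℕ) : List ℕ := (List.range n).flatMap fun t => lambdaWord (t + 1)

/-- `V` is a word `V(j,i)`, i.e. a word in the letters `a_j, a_{j+1}, …, a_i`. -/
def IsWordIn (j i : ℕ) (V : List ℕ) : Prop := ∀ m ∈ V, j ≤ m ∧ m ≤ i

/-- `V^{(s)}`: all indices are shifted by `s`. -/
def shiftWord (s : ℕ) (V : List ℕ) : List ℕ := V.map (· + s)

/-- The product in a monoid `M` of the elements `g_i` along an index word, for a family
`g_1, …, g_n` (only applied to index words with all entries in `{1, …, n}`). -/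
def evalWord {M : Type*} [Monoid M] {n : ℕ} (g : Set.Icc 1 n → M) (l : List ℕ) : M :=
  (l.map fun i => if h : 1 ≤ i ∧ i ≤ n then g ⟨i, h⟩ else 1).prod

/-! ### The braid group -/

/-- The defining relations of the braid group with Artin generators `a_1, …, a_n`. -/
inductive BraidRelator (n : ℕ) : FreeGroup (Set.Icc 1 n) → Prop
  | braid (i j : Set.Icc 1 n) (h : j.1 = i.1 + 1) :
      BraidRelator n (.of j * .of i * .of j * (.of i * .of j * .of i)⁻¹)
  | comm (m s : Set.Icc 1 n) (h : s.1 + 1 < m.1) :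
      BraidRelator n (.of m * .of s * (.of s * .of m)⁻¹)

/-- The braid group `B_{n+1}` on `n + 1` strands, in its Artin presentation on `n` generators. -/
abbrev BraidGroup (n : ℕ) : Type := PresentedGroup {r | BraidRelator n r}

/-- The Artin generator `a_i` of `B_{n+1}`. -/
def artinGen (n : ℕ) (i : Set.Icc 1 n) : BraidGroup n := PresentedGroup.of i

/-- The Garside element `Δ = Λ_1 Λ_2 ⋯ Λ_n` of `B_{n+1}`. -/
def garsideElement (n : ℕ) : BraidGroup n := evalWord (artinGen n) (garsideWord n)

/-! ### The Artin–Garside generators and relations -/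

/-- The alphabet `Δ⁻¹, Δ, a_1, …, a_n`. -/
inductive AGLetter (n : ℕ) : Type
  | deltaInv : AGLetter n
  | delta : AGLetter n
  | a (i : Set.Icc 1 n) : AGLetter n

namespace AGLetter

/-- The position of a letter in the order `Δ⁻¹ < Δ < a_1 < ⋯ < a_n`. -/
def rank {n : ℕ} : AGLetter n → ℕ
  | deltaInv => 0
  | delta => 1
  | a i => i.1 + 1

theorem rank_injective (n : ℕ) : Function.Injective (rank (n := n)) := by
  intro x y h
  cases x <;> cases y <;> simp only [rank] at h
  case a.a i j => exact congrArg a (Subtype.ext (by omega))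
  case a.delta i => exact absurd i.2.1 (by omega)
  case delta.a i => exact absurd i.2.1 (by omega)
  all_goals first | rfl | omega

/-- The order `Δ⁻¹ < Δ < a_1 < ⋯ < a_n`. -/
instance (n : ℕ) : LinearOrder (AGLetter n) := LinearOrder.lift' rank (rank_injective n)

/-- The element of `B_{n+1}` denoted by a letter. -/
def toBraid {n : ℕ} : AGLetter n → BraidGroup n
  | deltaInv => (garsideElement n)⁻¹
  | delta => garsideElement n
  | a i => artinGen n i

end AGLetter

/-- The one-letter word `Δ`. -/
def wDelta (n : ℕ) : FreeMonoid (AGLetter n) := FreeMonoid.of .delta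

/-- The one-letter word `Δ⁻¹`. -/
def wDeltaInv (n : ℕ) : FreeMonoid (AGLetter n) := FreeMonoid.of .deltaInv

/-- The word in `a_1, …, a_n` with the given index word. -/
def wArtin (n : ℕ) (l : List ℕ) : FreeMonoid (AGLetter n) :=
  evalWord (fun i => FreeMonoid.of (AGLetter.a i)) l

/-- The index word of `Λ_1 V_1 Λ_2 V_2 ⋯ V_{n-1} Λ_n` (for `n ≥ 1`). -/
def garsideLeft (n : ℕ) (V : ℕ → List ℕ) : List ℕ :=
  ((List.range (n - 1)).flatMap fun t => lambdaWord (t + 1) ++ V (t + 1)) ++ lambdaWord n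

/-- The index word of `V_1^{(n-1)} V_2^{(n-2)} ⋯ V_{n-1}^{(1)}`. -/
def garsideRight (n : ℕ) (V : ℕ → List ℕ) : List ℕ :=
  (List.range (n - 1)).flatMap fun t => shiftWord (n - (t + 1)) (V (t + 1))

/-- The relations `u = v` of the braid group in the Artin–Garside generators. -/
inductive AGRelation (n : ℕ) : FreeMonoid (AGLetter n) → FreeMonoid (AGLetter n) → Prop
  /-- `a_{i+1} a_i V(1,i-1) W(j,i) a_{i+1,j} = a_i a_{i+1} a_i V(1,i-1) a_{ij} W(j,i)'`,
  where `W` begins with `a_i` if it is not empty. -/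
  | braid (i j : ℕ) (V W : List ℕ) (hi : 1 ≤ i) (hin : i + 1 ≤ n) (hj : 1 ≤ j) (hji : j ≤ i + 1)
      (hV : IsWordIn 1 (i - 1) V) (hW : IsWordIn j i W) (hWi : W = [] ∨ W.head? = some i) :
      AGRelation n
        (wArtin n ([i + 1, i] ++ V ++ W ++ descWord (i + 1) j))
        (wArtin n ([i, i + 1, i] ++ V ++ descWord i j ++ shiftWord 1 W))
  /-- `a_s a_m = a_m a_s` for `s - m ≥ 2`. -/
  | comm (s m : ℕ) (hm : 1 ≤ m) (hs : s ≤ n) (hms : m + 2 ≤ s) :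
      AGRelation n (wArtin n [s, m]) (wArtin n [m, s])
  /-- `Λ_1 V_1 Λ_2 V_2 ⋯ V_{n-1} Λ_n = Δ V_1^{(n-1)} V_2^{(n-2)} ⋯ V_{n-1}'`. -/
  | garside (V : ℕ → List ℕ) (hV : ∀ i, 1 ≤ i → i ≤ n - 1 → IsWordIn 1 i (V i)) :
      AGRelation n (wArtin n (garsideLeft n V)) (wDelta n * wArtin n (garsideRight n V))
  /-- `a_l Δ = Δ a_{n-l+1}`. -/
  | delta (l : ℕ) (hl : 1 ≤ l) (hln : l ≤ n) :
      AGRelation n (wArtin n [l] * wDelta n) (wDelta n * wArtin n [n - l + 1])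
  /-- `a_l Δ⁻¹ = Δ⁻¹ a_{n-l+1}`. -/
  | deltaInv (l : ℕ) (hl : 1 ≤ l) (hln : l ≤ n) :
      AGRelation n (wArtin n [l] * wDeltaInv n) (wDeltaInv n * wArtin n [n - l + 1])
  /-- `Δ Δ⁻¹ = 1`. -/
  | mul_inv : AGRelation n (wDelta n * wDeltaInv n) 1
  /-- `Δ⁻¹ Δ = 1`. -/
  | inv_mul : AGRelation n (wDeltaInv n * wDelta n) 1

/-! ### The positive braid monoid on infinitely many strands -/

/-! Read each relation of S from left to right as a rewriting rule. A rule replaces a word by a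
deg-lex smaller one with the same value in the braid group, so every word rewrites to an irreducible
one. Everything rests on the fact that distinct irreducible words denote distinct braids
(`ArtinGarside.eq_of_toBraid_eq`). A composition is a difference of two words below w with the same
value. Both reduce to the same irreducible word, and each rewriting step contributes one admissible
summand, so no composition has to be computed. The same argument makes the map from the presented
monoid injective. It is surjective because a_i m = Δ for some positive word m, whence a_i⁻¹ = m Δ⁻¹.

Uniqueness comes from the monoid of positive braids, where `∣` means left divisibility. Garside's
lemma (`lcmForm_of_eq`) controls common multiples of two generators and gives cancellation. Powers
of Δ give common left multiples, so the monoid embeds in a group of fractions, and equality of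
positive words in the braid group is equality of positive braids (`evalWord_artinGen_eq_iff`). One
monoid with generators indexed by ℕ serves all n; the words of interest use the letters 1, …, n.

An irreducible word has the form Δ^z l with l positive. Avoiding the commutation and braid rules
makes every letter of l the least generator dividing the suffix it begins (`lexMin_of_braidFree`),
so l is determined by its positive braid. A minimal word divisible by Δ begins with the left side of
a Garside rule (`exists_garsideLeft_append`), so Δ does not divide l. If Δ^z l and Δ^z' l' agree
with z ≤ z', then l = Δ^(z'-z) l' as positive braids, which forces z = z' and then l = l'. -/

/-- The braid relations on generators indexed by `ℕ`. -/
inductive PosBraidRel : FreeMonoid ℕ → FreeMonoid ℕ → Prop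
  | braid (i : ℕ) : PosBraidRel (.of (i + 1) * .of i * .of (i + 1)) (.of i * .of (i + 1) * .of i)
  | comm (i j : ℕ) (h : i + 2 ≤ j) : PosBraidRel (.of j * .of i) (.of i * .of j)

/-- The monoid of positive braids on infinitely many strands. -/
abbrev PosBraid : Type := PresentedMonoid PosBraidRel

namespace PosBraid

/-- The generators of the positive braid monoid. -/
def σ (i : ℕ) : PosBraid := PresentedMonoid.of PosBraidRel i

/-- The positive braid given by an index word. -/
def word (l : List ℕ) : PosBraid := (l.map σ).prod

@[simp] theorem word_nil : word [] = 1 := rfl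

@[simp] theorem word_cons (i : ℕ) (l : List ℕ) : word (i :: l) = σ i * word l := by simp [word]

@[simp] theorem word_append (l m : List ℕ) : word (l ++ m) = word l * word m := by simp [word]

theorem mk_eq_word (u : FreeMonoid ℕ) : PresentedMonoid.mk PosBraidRel u = word u.toList := by
  induction u using FreeMonoid.inductionOn' with
  | one => rfl
  | of_mul x u ih => rw [map_mul, ih]; simp [σ, PresentedMonoid.of]

theorem exists_word (x : PosBraid) : ∃ l, word l = x := by
  obtain ⟨u, rfl⟩ := PresentedMonoid.surjective_mk x
  exact ⟨u.toList, (mk_eq_word u).symm⟩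

/-- Two generators that commute. -/
def Far (i k : ℕ) : Prop := i + 2 ≤ k ∨ k + 2 ≤ i

/-- Two generators that satisfy a braid relation. -/
def Adj (i k : ℕ) : Prop := i + 1 = k ∨ k + 1 = i

theorem Far.symm {i k : ℕ} (h : Far i k) : Far k i := by unfold Far at *; omega

theorem Adj.symm {i k : ℕ} (h : Adj i k) : Adj k i := by unfold Adj at *; omega

theorem eq_or_far_or_adj (i k : ℕ) : i = k ∨ Far i k ∨ Adj i k := by unfold Far Adj; omega

theorem comm {i k : ℕ} (h : Far i k) : σ i * σ k = σ k * σ i := by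
  have key : ∀ i k, i + 2 ≤ k → σ k * σ i = σ i * σ k := fun i k h =>
    PresentedMonoid.mk_eq_mk_of_rel (PosBraidRel.comm i k h)
  rcases h with h | h
  · exact (key _ _ h).symm
  · exact key _ _ h

theorem braid {i k : ℕ} (h : Adj i k) : σ i * (σ k * σ i) = σ k * (σ i * σ k) := by
  have key : ∀ i, σ (i + 1) * (σ i * σ (i + 1)) = σ i * (σ (i + 1) * σ i) := fun i => by
    rw [← mul_assoc, ← mul_assoc]
    exact PresentedMonoid.mk_eq_mk_of_rel (PosBraidRel.braid i)
  rcases h with rfl | rfl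
  · exact (key _).symm
  · exact key _

theorem comm_mul {i k : ℕ} (h : Far i k) (x : PosBraid) : σ i * (σ k * x) = σ k * (σ i * x) := by
  rw [← mul_assoc, comm h, mul_assoc]

theorem braid_mul {i k : ℕ} (h : Adj i k) (x : PosBraid) :
    σ i * (σ k * (σ i * x)) = σ k * (σ i * (σ k * x)) := by
  simpa only [mul_assoc] using congrArg (· * x) (braid h)

/-- The length of a positive braid, as a homomorphism. -/
def lenHom : PosBraid →* Multiplicative ℕ :=
  PresentedMonoid.lift (fun _ => Multiplicative.ofAdd 1) (by
    rintro _ _ (_ | ⟨i, j, h⟩) <;> rfl)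

/-- The length of a positive braid. -/
def len (x : PosBraid) : ℕ := (lenHom x).toAdd

@[simp] theorem len_one : len 1 = 0 := by simp [len]

@[simp] theorem len_mul (x y : PosBraid) : len (x * y) = len x + len y := by simp [len]

@[simp] theorem len_σ (i : ℕ) : len (σ i) = 1 := rfl

@[simp] theorem len_word (l : List ℕ) : len (word l) = l.length := by
  induction l with
  | nil => simp
  | cons i l ih => simp [ih, add_comm]

/-! ### Garside's lemma on common multiples of two generators -/

/-- The conclusion of Garside's lemma on an equation `σ i * x = σ k * y`. -/
def LcmForm (i k : ℕ) (x y : PosBraid) : Prop :=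
  (i = k ∧ x = y) ∨ (Far i k ∧ ∃ z, x = σ k * z ∧ y = σ i * z) ∨
    (Adj i k ∧ ∃ z, x = σ k * (σ i * z) ∧ y = σ i * (σ k * z))

namespace LcmForm

theorem refl (i : ℕ) (x : PosBraid) : LcmForm i i x x := Or.inl ⟨rfl, rfl⟩

theorem symm {i k : ℕ} {x y : PosBraid} (h : LcmForm i k x y) : LcmForm k i y x := by
  rcases h with ⟨rfl, rfl⟩ | ⟨h, z, hx, hy⟩ | ⟨h, z, hx, hy⟩
  · exact refl _ _
  · exact Or.inr (Or.inl ⟨h.symm, z, hy, hx⟩)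
  · exact Or.inr (Or.inr ⟨h.symm, z, hy, hx⟩)

theorem mul_right {i k : ℕ} {x y : PosBraid} (h : LcmForm i k x y) (u : PosBraid) :
    LcmForm i k (x * u) (y * u) := by
  rcases h with ⟨rfl, rfl⟩ | ⟨h, z, rfl, rfl⟩ | ⟨h, z, rfl, rfl⟩
  · exact refl _ _
  · exact Or.inr (Or.inl ⟨h, z * u, mul_assoc _ _ _, mul_assoc _ _ _⟩)
  · exact Or.inr (Or.inr ⟨h, z * u, by simp only [mul_assoc], by simp only [mul_assoc]⟩)

theorem of_eq {i : ℕ} {x y : PosBraid} (h : LcmForm i i x y) : x = y := by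
  rcases h with ⟨_, rfl⟩ | ⟨h, _⟩ | ⟨h, _⟩
  · rfl
  · unfold Far at h; omega
  · unfold Adj at h; omega

theorem of_far {i k : ℕ} {x y : PosBraid} (h : LcmForm i k x y) (hik : Far i k) :
    ∃ z, x = σ k * z ∧ y = σ i * z := by
  rcases h with ⟨rfl, rfl⟩ | ⟨h, hz⟩ | ⟨h, _⟩
  · unfold Far at hik; omega
  · exact hz
  · unfold Far at hik; unfold Adj at h; omega

theorem of_adj {i k : ℕ} {x y : PosBraid} (h : LcmForm i k x y) (hik : Adj i k) :
    ∃ z, x = σ k * (σ i * z) ∧ y = σ i * (σ k * z) := by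
  rcases h with ⟨rfl, rfl⟩ | ⟨h, _⟩ | ⟨h, hz⟩
  · unfold Adj at hik; omega
  · unfold Adj at hik; unfold Far at h; omega
  · exact hz

/-- If i and k are adjacent, then i, k, m form a chain, and the common multiple found is the Garside
element on four strands, of length six. -/
theorem trans_far_adj {L : ℕ}
    (IH : ∀ i k x y, len x < L → σ i * x = σ k * y → LcmForm i k x y)
    {i m k : ℕ} {z y : PosBraid} (hzL : len z + 1 ≤ L)
    (him : Far i m) (hmk : Adj m k) (h : σ i * z = σ k * (σ m * y)) :
    LcmForm i k (σ m * z) (σ m * (σ k * y)) := by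
  have hz := IH _ _ _ _ (by omega) h
  have hlen := congrArg len h
  simp only [len_mul, len_σ] at hlen
  rcases eq_or_far_or_adj i k with rfl | hik | hik
  · unfold Far at him; unfold Adj at hmk; omega
  · obtain ⟨t, rfl, ht⟩ := hz.of_far hik
    obtain ⟨u, rfl, rfl⟩ := (IH _ _ _ _ (by omega) ht).of_far him.symm
    refine Or.inr (Or.inl ⟨hik, σ m * (σ k * u), braid_mul hmk u, ?_⟩)
    rw [comm_mul hik.symm, comm_mul him.symm]
  · obtain ⟨t, rfl, ht⟩ := hz.of_adj hik
    simp only [len_mul, len_σ] at hlen hzL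
    obtain ⟨u, rfl, hu⟩ := (IH _ _ _ _ (by omega) ht).of_far him.symm
    simp only [len_mul, len_σ] at hlen
    have hu' := congrArg len hu
    simp only [len_mul, len_σ] at hu'
    obtain ⟨s, rfl, rfl⟩ := (IH _ _ _ _ (by omega) hu).of_adj hmk.symm
    refine Or.inr (Or.inr ⟨hik, σ m * (σ k * (σ i * s)), ?_, ?_⟩)
    · rw [comm_mul him, braid_mul hmk, braid_mul hik.symm, comm_mul him.symm]
    · rw [braid_mul hik.symm, comm_mul him.symm, ← braid_mul hmk, comm_mul him.symm s]

theorem trans_adj_adj {L : ℕ}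
    (IH : ∀ i k x y, len x < L → σ i * x = σ k * y → LcmForm i k x y)
    {i m k : ℕ} {z y : PosBraid} (hzL : len z + 2 ≤ L) (hne : i ≠ k)
    (him : Adj i m) (hmk : Adj m k) (h : σ i * (σ m * z) = σ k * (σ m * y)) :
    LcmForm i k (σ m * (σ i * z)) (σ m * (σ k * y)) := by
  have hik : Far i k := by unfold Far; unfold Adj at him hmk; omega
  have hlen := congrArg len h
  simp only [len_mul, len_σ] at hlen
  obtain ⟨t, ht, ht'⟩ := (IH _ _ _ _ (by simp; omega) h).of_far hik
  obtain ⟨u, rfl, rfl⟩ := (IH _ _ _ _ (by omega) ht).of_adj hmk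
  simp only [len_mul, len_σ] at hlen hzL
  obtain ⟨v, rfl, hv⟩ := (IH _ _ _ _ (by omega) ht').of_adj him.symm
  -- Both expressions for the tail begin with `σ m`; cancelling it leaves an equation between
  -- multiples of the commuting generators k and i.
  have hv := IH _ _ _ _ (by omega) (IH _ _ _ _ (by simp; omega) hv).of_eq
  obtain ⟨s, rfl, rfl⟩ := hv.of_far hik.symm
  refine Or.inr (Or.inl ⟨hik, σ m * (σ k * (σ i * (σ m * s))), ?_, ?_⟩)
  · rw [comm_mul hik, braid_mul him, braid_mul hmk]
  · rw [← comm_mul hik, braid_mul hmk.symm, braid_mul him.symm, comm_mul hik]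

/-- `IH` is Garside's lemma for shorter tails. A chain of congruences may pass through a word with a
third first letter m; the common multiples for i, m and for m, k must then be combined into one for
i, k. -/
theorem trans {L : ℕ}
    (IH : ∀ i k x y, len x < L → σ i * x = σ k * y → LcmForm i k x y)
    {i m k : ℕ} {x w y : PosBraid} (hx : len x ≤ L) (h₁ : LcmForm i m x w)
    (h₂ : LcmForm m k w y) : LcmForm i k x y := by
  rcases h₁ with ⟨rfl, rfl⟩ | ⟨him, z, rfl, rfl⟩ | ⟨him, z, rfl, rfl⟩
  · exact h₂
  · simp only [len_mul, len_σ] at hx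
    rcases h₂ with ⟨rfl, rfl⟩ | ⟨hmk, y, h, rfl⟩ | ⟨hmk, y, h, rfl⟩
    · exact Or.inr (Or.inl ⟨him, z, rfl, rfl⟩)
    · have hz := IH _ _ _ _ (by omega) h
      rcases hz with ⟨rfl, rfl⟩ | ⟨hik, t, rfl, rfl⟩ | ⟨hik, t, rfl, rfl⟩
      · exact refl _ _
      · exact Or.inr (Or.inl ⟨hik, σ m * t, comm_mul hmk _, comm_mul him.symm _⟩)
      · refine Or.inr (Or.inr ⟨hik, σ m * t, ?_, ?_⟩)
        · rw [comm_mul hmk, comm_mul him.symm]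
        · rw [comm_mul him.symm, comm_mul hmk]
    · exact trans_far_adj IH (by omega) him hmk h
  · simp only [len_mul, len_σ] at hx
    rcases h₂ with ⟨rfl, rfl⟩ | ⟨hmk, y, h, rfl⟩ | ⟨hmk, y, h, rfl⟩
    · exact Or.inr (Or.inr ⟨him, z, rfl, rfl⟩)
    · have hlen := congrArg len h
      simp only [len_mul, len_σ] at hlen
      exact (trans_far_adj IH (by omega) hmk.symm him.symm h.symm).symm
    · by_cases hik : i = k
      · subst hik
        have := (IH _ _ _ _ (by simp; omega) h).of_eq
        have := (IH _ _ _ _ (by omega) this).of_eq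
        subst this
        exact refl _ _
      · exact trans_adj_adj IH (by omega) hik him hmk h

end LcmForm

/-- The statement of Garside's lemma for two congruent words, up to a bound on the length. -/
theorem lcmForm_of_rel {L : ℕ}
    (IH : ∀ i k x y, len x < L → σ i * x = σ k * y → LcmForm i k x y)
    {u v : FreeMonoid ℕ} (h : ConGen.Rel PosBraidRel u v) :
    ∀ i k A B, u.toList = i :: A → v.toList = k :: B → A.length ≤ L →
      LcmForm i k (word A) (word B) := by
  have hmk : ∀ {u v}, ConGen.Rel PosBraidRel u v → word u.toList = word v.toList :=
    fun {u v} h => by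
      rw [← mk_eq_word, ← mk_eq_word]; exact PresentedMonoid.mk_eq_mk_iff.2 h
  induction h with
  | of u v h =>
    intro i k A B hA hB _
    rcases h with ⟨j⟩ | ⟨j, l, h⟩
    · simp at hA hB
      obtain ⟨rfl, rfl⟩ := hA
      obtain ⟨rfl, rfl⟩ := hB
      exact Or.inr (Or.inr ⟨Or.inr rfl, 1, by simp, by simp⟩)
    · simp at hA hB
      obtain ⟨rfl, rfl⟩ := hA
      obtain ⟨rfl, rfl⟩ := hB
      exact Or.inr (Or.inl ⟨Or.inr h, 1, by simp, by simp⟩)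
  | refl u =>
    intro i k A B hA hB _
    rw [hA] at hB
    obtain ⟨rfl, rfl⟩ := List.cons.inj hB
    exact LcmForm.refl _ _
  | @symm u v h ih =>
    intro i k A B hA hB hL
    have hl := congrArg len (hmk h)
    rw [hA, hB] at hl
    simp at hl
    exact (ih k i B A hB hA (by omega)).symm
  | @trans u v w h h' ih ih' =>
    intro i k A B hA hB hL
    have hl := congrArg len (hmk h)
    rw [hA] at hl
    cases hv : v.toList with
    | nil => rw [hv] at hl; simp at hl
    | cons m C =>
      rw [hv] at hl
      simp at hl
      exact LcmForm.trans IH (by simpa using hL) (ih i m A C hA hv hL)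
        (ih' m k C B hv hB (by omega))
  -- The first letter of a product comes from the left factor unless that factor is empty; the right
  -- factor only replaces the end of the tail by an equal positive braid.
  | @mul u v u' v' h h' ih ih' =>
    intro i k A B hA hB hL
    have hl := congrArg len (hmk h)
    simp only [FreeMonoid.toList_mul] at hA hB
    cases hu : u.toList with
    | nil =>
      rw [hu] at hl hA
      have hv : v.toList = [] := List.length_eq_zero_iff.1 (by simpa using hl.symm)
      rw [hv] at hB
      exact ih' i k A B hA hB hL
    | cons m C =>
      cases hv : v.toList with
      | nil => rw [hu, hv] at hl; simp at hl
      | cons m' C' =>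
        rw [hu] at hA
        rw [hv] at hB
        obtain ⟨rfl, rfl⟩ := List.cons.inj hA
        obtain ⟨rfl, rfl⟩ := List.cons.inj hB
        rw [List.append_eq, List.append_eq, word_append, word_append, hmk h']
        simp at hL
        exact (ih m m' C C' hu hv (by omega)).mul_right _

/-- **Garside's lemma**: if two generators divide a positive braid from the left, then so does
their least common multiple; moreover generators can be cancelled from the left. -/
theorem lcmForm_of_eq {i k : ℕ} {x y : PosBraid} (h : σ i * x = σ k * y) : LcmForm i k x y := by
  -- Induction on a length bound; congruent words have equal length, so the bound covers every
  -- intermediate word of a derivation.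
  have key : ∀ L, ∀ i k x y, len x < L → σ i * x = σ k * y → LcmForm i k x y := by
    intro L
    induction L with
    | zero => intro i k x y h; omega
    | succ L ih =>
      intro i k x y hL h
      obtain ⟨A, rfl⟩ := exists_word x
      obtain ⟨B, rfl⟩ := exists_word y
      have hr : ConGen.Rel PosBraidRel (FreeMonoid.ofList (i :: A))
          (FreeMonoid.ofList (k :: B)) := by
        refine PresentedMonoid.mk_eq_mk_iff.1 ?_
        rw [mk_eq_word, mk_eq_word]
        simpa using h
      exact lcmForm_of_rel ih hr i k A B rfl rfl (by simpa [Nat.lt_succ_iff] using hL)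
  exact key (len x + 1) i k x y (Nat.lt_succ_self _) h

theorem σ_mul_cancel {i : ℕ} {x y : PosBraid} (h : σ i * x = σ i * y) : x = y :=
  (lcmForm_of_eq h).of_eq

instance : IsLeftCancelMul PosBraid where
  mul_left_cancel z x y h := by
    obtain ⟨l, rfl⟩ := exists_word z
    induction l with
    | nil => simpa using h
    | cons i l ih =>
      refine ih (σ_mul_cancel (i := i) ?_)
      simpa [mul_assoc] using h

end PosBraid

namespace PosBraid

/-! ### Index words -/

theorem descWord_succ {i j : ℕ} (h : j ≤ i + 1) : descWord (i + 1) j = (i + 1) :: descWord i j := by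
  unfold descWord
  rw [show i + 1 + 1 - j = (i + 1 - j) + 1 by omega, List.range_succ_eq_map, List.map_cons,
    List.map_map]
  refine congrArg₂ _ rfl (List.map_congr_left fun t _ => ?_)
  simp

@[simp] theorem descWord_self (i : ℕ) : descWord i i = [i] := by
  simp [descWord]

theorem descWord_eq_append {i j : ℕ} (h : j ≤ i) : descWord i j = descWord i (j + 1) ++ [j] := by
  unfold descWord
  rw [show i + 1 - j = (i + 1 - (j + 1)) + 1 by omega, List.range_succ, List.map_append]
  simp
  omega

theorem mem_descWord {i j m : ℕ} : m ∈ descWord i j ↔ j ≤ m ∧ m ≤ i := by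
  simp only [descWord, List.mem_map, List.mem_range]
  exact ⟨by rintro ⟨t, ht, rfl⟩; omega, fun h => ⟨i - m, by omega, by omega⟩⟩

theorem shiftWord_descWord (i j : ℕ) : shiftWord 1 (descWord i j) = descWord (i + 1) (j + 1) := by
  unfold shiftWord descWord
  rw [List.map_map, show i + 1 + 1 - (j + 1) = i + 1 - j by omega]
  refine List.map_congr_left fun t ht => ?_
  have := List.mem_range.1 ht
  simp
  omega

theorem isWordIn_nil (j i : ℕ) : IsWordIn j i [] := by simp [IsWordIn]

theorem isWordIn_cons {j i k : ℕ} {l : List ℕ} :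
    IsWordIn j i (k :: l) ↔ (j ≤ k ∧ k ≤ i) ∧ IsWordIn j i l := by simp [IsWordIn]

theorem isWordIn_append {j i : ℕ} {l m : List ℕ} :
    IsWordIn j i (l ++ m) ↔ IsWordIn j i l ∧ IsWordIn j i m := by
  simp only [IsWordIn, List.mem_append]
  exact ⟨fun h => ⟨fun k hk => h k (Or.inl hk), fun k hk => h k (Or.inr hk)⟩,
    fun h k hk => hk.elim (h.1 k) (h.2 k)⟩

theorem _root_.IsWordIn.mono {j i j' i' : ℕ} {l : List ℕ} (h : IsWordIn j i l) (hj : j' ≤ j)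
    (hi : i ≤ i') : IsWordIn j' i' l :=
  fun m hm => ⟨hj.trans (h m hm).1, (h m hm).2.trans hi⟩

theorem _root_.IsWordIn.shift {j i : ℕ} {l : List ℕ} (h : IsWordIn j i l) (s : ℕ) :
    IsWordIn (j + s) (i + s) (shiftWord s l) := by
  intro m hm
  obtain ⟨k, hk, rfl⟩ := List.mem_map.1 hm
  have := h k hk
  omega

theorem isWordIn_descWord (i j : ℕ) : IsWordIn j i (descWord i j) := fun _ hm => mem_descWord.1 hm

theorem shiftWord_shiftWord (s t : ℕ) (l : List ℕ) :
    shiftWord s (shiftWord t l) = shiftWord (t + s) l := by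
  simp [shiftWord, Function.comp_def, add_assoc]

/-! ### The two sides of the Garside rule -/

/-- The index word of `Λ_i V_i Λ_{i+1} ⋯ V_{i+d-1} Λ_{i+d}`. -/
def leftWord (V : ℕ → List ℕ) : ℕ → ℕ → List ℕ
  | i, 0 => lambdaWord i
  | i, d + 1 => lambdaWord i ++ V i ++ leftWord V (i + 1) d

/-- The index word of `V_i^{(d)} V_{i+1}^{(d-1)} ⋯ V_{i+d-1}^{(1)}`. -/
def rightWord (V : ℕ → List ℕ) : ℕ → ℕ → List ℕ
  | _, 0 => []
  | i, d + 1 => shiftWord (d + 1) (V i) ++ rightWord V (i + 1) d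

theorem leftWord_eq (V : ℕ → List ℕ) (i d : ℕ) : leftWord V i d =
    ((List.range d).flatMap fun t => lambdaWord (t + i) ++ V (t + i)) ++ lambdaWord (d + i) := by
  induction d generalizing i with
  | zero => simp [leftWord]
  | succ d ih =>
    rw [leftWord, ih, List.range_succ_eq_map, List.flatMap_cons, List.flatMap_map]
    simp [add_assoc, add_comm 1 i]

theorem rightWord_eq (V : ℕ → List ℕ) (i d : ℕ) : rightWord V i d =
    (List.range d).flatMap fun t => shiftWord (d - t) (V (t + i)) := by
  induction d generalizing i with
  | zero => simp [rightWord]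
  | succ d ih =>
    rw [rightWord, ih, List.range_succ_eq_map, List.flatMap_cons, List.flatMap_map]
    simp [add_assoc, add_comm 1 i]

theorem garsideLeft_eq {n : ℕ} (hn : 1 ≤ n) (V : ℕ → List ℕ) :
    garsideLeft n V = leftWord V 1 (n - 1) := by
  rw [leftWord_eq, garsideLeft, Nat.sub_add_cancel hn]

theorem garsideRight_eq {n : ℕ} (V : ℕ → List ℕ) :
    garsideRight n V = rightWord V 1 (n - 1) := by
  rw [rightWord_eq, garsideRight]
  simp only [Nat.sub_sub, Nat.add_comm]

theorem garsideWord_succ (n : ℕ) : garsideWord (n + 1) = garsideWord n ++ lambdaWord (n + 1) := by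
  simp [garsideWord, List.range_succ]

theorem garsideWord_eq {n : ℕ} (hn : 1 ≤ n) : garsideWord n = leftWord (fun _ => []) 1 (n - 1) := by
  obtain ⟨n, rfl⟩ := Nat.exists_eq_add_of_le' hn
  rw [leftWord_eq, garsideWord_succ]
  simp [garsideWord]

theorem leftWord_congr {V V' : ℕ → List ℕ} {i d : ℕ} (h : ∀ m, i ≤ m → V m = V' m) :
    leftWord V i d = leftWord V' i d := by
  induction d generalizing i with
  | zero => rfl
  | succ d ih => rw [leftWord, leftWord, h i le_rfl, ih fun m hm => h m (by omega)]

theorem isWordIn_lambdaWord (i : ℕ) : IsWordIn 1 i (lambdaWord i) := isWordIn_descWord i 1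

theorem isWordIn_garsideWord (n : ℕ) : IsWordIn 1 n (garsideWord n) := by
  induction n with
  | zero => simp [garsideWord, IsWordIn]
  | succ n ih =>
    rw [garsideWord_succ, isWordIn_append]
    exact ⟨ih.mono le_rfl (by omega), isWordIn_lambdaWord _⟩

theorem isWordIn_leftWord {V : ℕ → List ℕ} {i d n : ℕ} (hn : i + d ≤ n)
    (hV : ∀ m, i ≤ m → m < i + d → IsWordIn 1 m (V m)) : IsWordIn 1 n (leftWord V i d) := by
  induction d generalizing i with
  | zero => exact (isWordIn_lambdaWord i).mono le_rfl hn
  | succ d ih =>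
    rw [leftWord, isWordIn_append, isWordIn_append]
    exact ⟨⟨(isWordIn_lambdaWord i).mono le_rfl (by omega),
      (hV i le_rfl (by omega)).mono le_rfl (by omega)⟩,
      ih (by omega) fun m hm hm' => hV m (by omega) (by omega)⟩

theorem isWordIn_rightWord {V : ℕ → List ℕ} {i d n : ℕ} (hn : i + d ≤ n)
    (hV : ∀ m, i ≤ m → m < i + d → IsWordIn 1 m (V m)) : IsWordIn 1 n (rightWord V i d) := by
  induction d generalizing i with
  | zero => exact isWordIn_nil _ _
  | succ d ih =>
    rw [rightWord, isWordIn_append]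
    exact ⟨((hV i le_rfl (by omega)).shift (d + 1)).mono (by omega) (by omega),
      ih (by omega) fun m hm hm' => hV m (by omega) (by omega)⟩

/-! ### Identities in the positive braid monoid -/

theorem σ_mul_word_of_far {k : ℕ} {l : List ℕ} (h : ∀ m ∈ l, Far k m) :
    σ k * word l = word l * σ k := by
  induction l with
  | nil => simp
  | cons m l ih =>
    rw [word_cons, comm_mul (h m (by simp)), ih fun m hm => h m (by simp [hm]), mul_assoc]

/-- Letters above k + 1 commute with `σ k`, the pair k + 1, k turns it into `σ (k + 1)` by a braid
relation, and that generator commutes with the letters below k. The braid and Garside rules both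
rest on this shift. -/
theorem σ_mul_descWord {i j k : ℕ} (hj : j ≤ k) (hk : k ≤ i) :
    σ k * word (descWord (i + 1) j) = word (descWord (i + 1) j) * σ (k + 1) := by
  induction i with
  | zero =>
    obtain rfl : k = 0 := by omega
    obtain rfl : j = 0 := by omega
    simpa [descWord_succ, mul_assoc] using braid (Or.inl rfl : Adj 0 1)
  | succ i ih =>
    rw [descWord_succ (by omega), word_cons]
    rcases Nat.lt_or_ge i k with h | h
    · obtain rfl : k = i + 1 := by omega
      rw [descWord_succ (by omega), word_cons, braid_mul (Or.inl rfl), mul_assoc, mul_assoc,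
        σ_mul_word_of_far]
      intro m hm
      have := mem_descWord.1 hm
      exact Or.inr (by omega)
    · rw [comm_mul (Or.inl (by omega)), ih h, mul_assoc]

theorem word_mul_descWord {i j : ℕ} {V : List ℕ} (hV : IsWordIn j i V) :
    word V * word (descWord (i + 1) j) = word (descWord (i + 1) j) * word (shiftWord 1 V) := by
  induction V with
  | nil => simp [shiftWord]
  | cons k V ih =>
    rw [isWordIn_cons] at hV
    rw [word_cons, mul_assoc, ih hV.2, ← mul_assoc, σ_mul_descWord hV.1.1 hV.1.2]
    simp [shiftWord, mul_assoc]

/-- Each of the d + 1 factors raises the indices of U by one, in step with the growing index of the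
next factor. -/
theorem word_mul_leftWord {i d : ℕ} {U : List ℕ} (hi : 1 ≤ i) (hU : IsWordIn 1 (i - 1) U) :
    word U * word (leftWord (fun _ => []) i d) =
      word (leftWord (fun _ => []) i d) * word (shiftWord (d + 1) U) := by
  obtain ⟨i, rfl⟩ := Nat.exists_eq_add_of_le' hi
  simp only [Nat.add_sub_cancel] at hU
  induction d generalizing i U with
  | zero => exact word_mul_descWord hU
  | succ d ih =>
    rw [leftWord, List.append_nil, word_append, ← mul_assoc, lambdaWord, word_mul_descWord hU,
      mul_assoc, ih (i + 1) (by omega) ((hU.shift 1).mono (by omega) le_rfl), shiftWord_shiftWord,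
      mul_assoc, add_comm 1]

theorem word_leftWord {V : ℕ → List ℕ} {i d : ℕ} (hi : 1 ≤ i)
    (hV : ∀ m, i ≤ m → m < i + d → IsWordIn 1 m (V m)) :
    word (leftWord V i d) = word (leftWord (fun _ => []) i d) * word (rightWord V i d) := by
  induction d generalizing i with
  | zero => simp [leftWord, rightWord]
  | succ d ih =>
    rw [leftWord, leftWord, rightWord, List.append_nil, word_append, word_append, word_append,
      word_append, ih (by omega) fun m hm hm' => hV m (by omega) (by omega), mul_assoc, mul_assoc,
      ← mul_assoc (word (V i)), word_mul_leftWord (by omega)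
      (by simpa using hV i le_rfl (by omega)), mul_assoc]

/-- W moves past a_{i+1,j} with a shift, V commutes with a_{i+1}, and a single braid relation
remains. -/
theorem braid_relation {i j : ℕ} {V W : List ℕ} (hi : 1 ≤ i) (hji : j ≤ i + 1)
    (hV : IsWordIn 1 (i - 1) V) (hW : IsWordIn j i W) :
    word ([i + 1, i] ++ V ++ W ++ descWord (i + 1) j) =
      word ([i, i + 1, i] ++ V ++ descWord i j ++ shiftWord 1 W) := by
  have hc : word V * σ (i + 1) = σ (i + 1) * word V :=
    (σ_mul_word_of_far fun m hm => Or.inr (by have := hV m hm; omega)).symm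
  simp only [word_append, word_cons, word_nil, mul_one, mul_assoc]
  rw [word_mul_descWord hW, descWord_succ hji, word_cons, mul_assoc, ← mul_assoc (word V), hc,
    mul_assoc, braid_mul (Or.inr rfl)]

/-! ### The Garside element as a positive braid -/

/-- The Garside element of the braid group with generators `1, …, n`, as a positive braid. -/
def delta (n : ℕ) : PosBraid := word (garsideWord n)

theorem delta_succ (n : ℕ) : delta (n + 1) = delta n * word (lambdaWord (n + 1)) := by
  rw [delta, garsideWord_succ, word_append, delta]

theorem delta_succ' (n : ℕ) :
    delta (n + 1) = word (lambdaWord (n + 1)) * word (shiftWord 1 (garsideWord n)) := by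
  rw [delta_succ, delta, lambdaWord, word_mul_descWord (isWordIn_garsideWord n)]

theorem garside_relation {n : ℕ} {V : ℕ → List ℕ} (hn : 1 ≤ n)
    (hV : ∀ i, 1 ≤ i → i ≤ n - 1 → IsWordIn 1 i (V i)) :
    word (garsideLeft n V) = delta n * word (garsideRight n V) := by
  rw [garsideLeft_eq hn, garsideRight_eq, delta, garsideWord_eq hn,
    word_leftWord le_rfl fun m hm hm' => hV m hm (by omega)]

/-- Moving Λ_{m+1} to the right of Λ_{m+2} shifts it to a_{m+2,2}, which `σ 1` completes to Λ_{m+2}.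
-/
theorem lambdaWord_mul_lambdaWord (m : ℕ) :
    word (lambdaWord (m + 1)) * word (lambdaWord (m + 2)) * σ 1 =
      word (lambdaWord (m + 2)) * word (lambdaWord (m + 2)) := by
  have h : word (lambdaWord (m + 2)) = word (descWord (m + 2) 2) * σ 1 := by
    rw [lambdaWord, descWord_eq_append (by omega), word_append]; simp
  rw [show word (lambdaWord (m + 1)) * word (lambdaWord (m + 2)) =
    word (lambdaWord (m + 2)) * word (shiftWord 1 (lambdaWord (m + 1))) from
    word_mul_descWord (isWordIn_lambdaWord _), lambdaWord, lambdaWord, shiftWord_descWord,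
    mul_assoc,
    ← h, lambdaWord]

/-- For l ≤ n, apply induction and shift once through Λ_{n+1}. The top generator instead commutes
with Δ_{n-1} and turns Λ_n into Λ_{n+1}, so the preceding identity applies. -/
theorem σ_mul_delta {n l : ℕ} (hl : 1 ≤ l) (hln : l ≤ n) :
    σ l * delta n = delta n * σ (n - l + 1) := by
  induction n with
  | zero => omega
  | succ n ih =>
    rcases Nat.lt_or_ge n l with h | h
    · obtain rfl : l = n + 1 := by omega
      rw [show n + 1 - (n + 1) + 1 = 1 by omega]
      cases n with
      | zero => simp [delta, garsideWord, lambdaWord]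
      | succ m =>
        have hc : σ (m + 2) * delta m = delta m * σ (m + 2) := σ_mul_word_of_far fun k hk =>
          Or.inr (by have := isWordIn_garsideWord m k hk; omega)
        have hd : word (lambdaWord (m + 2)) = σ (m + 2) * word (lambdaWord (m + 1)) := by
          rw [lambdaWord, descWord_succ (by omega), word_cons, lambdaWord]
        rw [delta_succ, delta_succ, mul_assoc, mul_assoc, lambdaWord_mul_lambdaWord,
          ← mul_assoc, hc, mul_assoc, ← mul_assoc (σ (m + 2)), ← hd]
    · rw [delta_succ, ← mul_assoc, ih h, mul_assoc, lambdaWord,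
        σ_mul_descWord (by omega) (by omega), mul_assoc,
        show n + 1 - l + 1 = n - l + 1 + 1 by omega]

theorem exists_σ_mul_eq_delta {n l : ℕ} (hl : 1 ≤ l) (hln : l ≤ n) :
    ∃ m, IsWordIn 1 n m ∧ σ l * word m = delta n := by
  induction n with
  | zero => omega
  | succ n ih =>
    rcases Nat.lt_or_ge n l with h | h
    · obtain rfl : l = n + 1 := by omega
      refine ⟨descWord n 1 ++ shiftWord 1 (garsideWord n), ?_, ?_⟩
      · exact isWordIn_append.2 ⟨(isWordIn_descWord _ _).mono le_rfl (by omega),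
          ((isWordIn_garsideWord n).shift 1).mono (by omega) le_rfl⟩
      · rw [delta_succ', lambdaWord, descWord_succ (by omega), word_append, word_cons, mul_assoc]
    · obtain ⟨m, hm, h⟩ := ih h
      refine ⟨m ++ lambdaWord (n + 1), ?_, ?_⟩
      · exact isWordIn_append.2 ⟨hm.mono le_rfl (by omega), isWordIn_lambdaWord _⟩
      · rw [word_append, ← mul_assoc, h, delta_succ]

theorem exists_mul_σ_eq_delta {n l : ℕ} (hl : 1 ≤ l) (hln : l ≤ n) :
    ∃ m, m * σ l = delta n := by
  obtain ⟨m, -, h⟩ := exists_σ_mul_eq_delta (n := n) (l := n - l + 1) (by omega) (by omega)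
  refine ⟨word m, σ_mul_cancel (i := n - l + 1) ?_⟩
  rw [σ_mul_delta (by omega) (by omega), ← mul_assoc, h, show n - (n - l + 1) + 1 = l by omega]

end PosBraid

namespace PosBraid

/-! ### Divisibility by descending words -/

theorem word_dvd_of_far {k : ℕ} {l : List ℕ} {v : PosBraid} (h : ∀ m ∈ l, Far k m)
    (hd : word l ∣ σ k * v) : word l ∣ v := by
  induction l generalizing v with
  | nil => simp
  | cons m l ih =>
    obtain ⟨y, hy⟩ := hd
    rw [word_cons, mul_assoc] at hy
    obtain ⟨z, rfl, hz⟩ := (lcmForm_of_eq hy).of_far (h m (by simp))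
    rw [word_cons]
    exact mul_dvd_mul_left _ (ih (fun m hm => h m (by simp [hm])) ⟨y, hz.symm⟩)

/-- The least common multiple of `σ k` and a_{i+1,j} is σ_k a_{i+1,j} = a_{i+1,j} σ_{k+1}. Garside's
lemma removes the descending word one letter at a time. -/
theorem descWord_dvd {i j k : ℕ} {v : PosBraid} (hj : j ≤ k) (hk : k ≤ i)
    (hd : word (descWord (i + 1) j) ∣ σ k * v) : word (descWord (i + 1) j) ∣ v := by
  induction i generalizing v with
  | zero =>
    obtain rfl : k = 0 := by omega
    obtain rfl : j = 0 := by omega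
    obtain ⟨y, hy⟩ := hd
    rw [descWord_succ (by omega), descWord_self, word_cons, mul_assoc] at hy
    obtain ⟨z, rfl, -⟩ := (lcmForm_of_eq hy).of_adj (Or.inl rfl)
    exact ⟨z, by simp [descWord_succ, mul_assoc]⟩
  | succ i ih =>
    obtain ⟨y, hy⟩ := hd
    rw [descWord_succ (by omega), word_cons, mul_assoc] at hy
    rw [descWord_succ (by omega), word_cons]
    rcases Nat.lt_or_ge i k with h | h
    · obtain rfl : k = i + 1 := by omega
      obtain ⟨z, rfl, hz⟩ := (lcmForm_of_eq hy).of_adj (Or.inl rfl)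
      rw [descWord_succ (by omega), word_cons, mul_assoc] at hz
      rw [descWord_succ (by omega), word_cons]
      refine mul_dvd_mul_left _ (mul_dvd_mul_left _ (word_dvd_of_far (k := i + 1 + 1) ?_
        ⟨y, (σ_mul_cancel hz).symm⟩))
      intro m hm
      have := mem_descWord.1 hm
      exact Or.inr (by omega)
    · obtain ⟨z, rfl, hz⟩ := (lcmForm_of_eq hy).of_far (Or.inl (by omega))
      exact mul_dvd_mul_left _ (ih h ⟨y, hz.symm⟩)

/-- Here the least common multiple is σ_p a_{i+1,p}: the letter just below the end of the descending
word lengthens it by one. -/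
theorem descWord_dvd_of_succ {i p : ℕ} {v : PosBraid} (hp : p ≤ i)
    (hd : word (descWord (i + 1) (p + 1)) ∣ σ p * v) : word (descWord (i + 1) p) ∣ v := by
  induction i generalizing v with
  | zero =>
    obtain rfl : p = 0 := by omega
    obtain ⟨y, hy⟩ := hd
    rw [descWord_self, word_cons, word_nil, mul_one] at hy
    obtain ⟨z, rfl, -⟩ := (lcmForm_of_eq hy).of_adj (Or.inl rfl)
    exact ⟨z, by simp [descWord_succ, mul_assoc]⟩
  | succ i ih =>
    obtain ⟨y, hy⟩ := hd
    rw [descWord_succ (by omega), word_cons, mul_assoc] at hy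
    rw [descWord_succ (by omega), word_cons]
    rcases Nat.lt_or_ge i p with h | h
    · obtain rfl : p = i + 1 := by omega
      obtain ⟨z, rfl, hz⟩ := (lcmForm_of_eq hy).of_adj (Or.inl rfl)
      exact ⟨z, by simp [mul_assoc]⟩
    · obtain ⟨z, rfl, hz⟩ := (lcmForm_of_eq hy).of_far (Or.inl (by omega))
      exact mul_dvd_mul_left _ (ih h ⟨y, hz.symm⟩)

/-- Past Λ_i the generator `σ k` becomes `σ (k + 1)`, still below the index of the next factor. -/
theorem leftWord_dvd {i d k : ℕ} {v : PosBraid} (hk : 1 ≤ k) (hki : k < i)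
    (hd : word (leftWord (fun _ => []) i d) ∣ σ k * v) :
    word (leftWord (fun _ => []) i d) ∣ v := by
  induction d generalizing i k v with
  | zero =>
    obtain ⟨i, rfl⟩ := Nat.exists_eq_add_of_le' (show 1 ≤ i by omega)
    exact descWord_dvd hk (by omega) hd
  | succ d ih =>
    obtain ⟨i, rfl⟩ := Nat.exists_eq_add_of_le' (show 1 ≤ i by omega)
    rw [leftWord, List.append_nil, word_append] at hd ⊢
    obtain ⟨v, rfl⟩ := descWord_dvd hk (by omega) ((dvd_mul_right _ _).trans hd)
    obtain ⟨y, hy⟩ := hd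
    rw [← mul_assoc, σ_mul_descWord hk (by omega), mul_assoc, lambdaWord, mul_assoc] at hy
    exact mul_dvd_mul_left _ (ih (k := k + 1) (by omega) (by omega) ⟨y, mul_left_cancel hy⟩)

/-! ### Lexicographically minimal words -/

/-- Every letter of the word is the least generator dividing the suffix that it begins. -/
def LexMin : List ℕ → Prop
  | [] => True
  | a :: t => (∀ m, σ m ∣ word (a :: t) → a ≤ m) ∧ LexMin t

/-- The word does not contain `a_s a_m` with `s ≥ m + 2` as a factor. -/
def CommFree (l : List ℕ) : Prop := ∀ s m, m + 2 ≤ s → ¬ [s, m] <:+: l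

theorem CommFree.tail {k : ℕ} {l : List ℕ} (h : CommFree (k :: l)) : CommFree l :=
  fun s m hs hi => h s m hs (List.infix_cons hi)

theorem CommFree.head {p k : ℕ} {l : List ℕ} (h : CommFree (p :: k :: l)) : p < k + 2 := by
  by_contra hc
  exact h p k (by omega) ⟨[], l, rfl⟩

theorem not_dvd_one (m : ℕ) : ¬ σ m ∣ 1 := by
  rintro ⟨y, hy⟩
  have := congrArg len hy
  simp at this
  omega

/-- Minimality makes the next letter drop by at least one, `CommFree` by at most one, so the
descending word is forced letter by letter. -/
theorem exists_descWord_append {i j : ℕ} {v : List ℕ} (hji : j ≤ i)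
    (hv : LexMin (i :: v)) (hc : CommFree (i :: v)) (hd : word (descWord i j) ∣ word (i :: v)) :
    ∃ t, i :: v = descWord i j ++ t := by
  induction i generalizing v with
  | zero =>
    obtain rfl : j = 0 := by omega
    exact ⟨v, by simp⟩
  | succ i ih =>
    rcases Nat.lt_or_ge i j with h | h
    · obtain rfl : j = i + 1 := by omega
      exact ⟨v, by simp⟩
    rw [descWord_succ (by omega), word_cons, word_cons] at hd
    have hd : word (descWord i j) ∣ word v := by
      obtain ⟨y, hy⟩ := hd
      exact ⟨y, σ_mul_cancel (hy.trans (mul_assoc _ _ _))⟩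
    have hi : σ i ∣ word v := by
      refine dvd_trans ?_ hd
      cases i with
      | zero => obtain rfl : j = 0 := by omega
                simp
      | succ i => rw [descWord_succ (by omega), word_cons]; exact dvd_mul_right _ _
    cases v with
    | nil => exact absurd hi (not_dvd_one i)
    | cons k v =>
      have h1 := hv.2.1 i hi
      have h2 := hc.head
      obtain rfl : i = k := by omega
      obtain ⟨t, ht⟩ := ih h hv.2 hc.tail hd
      exact ⟨t, by rw [ht, descWord_succ (by omega)]; rfl⟩

theorem σ_dvd_descWord {i j : ℕ} (h : j ≤ i + 1) : σ (i + 1) ∣ word (descWord (i + 1) j) := by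
  rw [descWord_succ h, word_cons]; exact dvd_mul_right _ _

/-- The factor `W(j,i) a_{i+1,j}` of a minimal word divisible by `a_{i+1,j}`. -/
theorem exists_append_descWord {i j p : ℕ} {v : List ℕ} (hj : 1 ≤ j) (hjp : j ≤ p) (hpi : p ≤ i)
    (hv : LexMin v) (hc : CommFree (p :: v)) (hpos : ∀ m ∈ v, 1 ≤ m)
    (hd : word (descWord (i + 1) j) ∣ word v) :
    ∃ W j' t, v = W ++ descWord (i + 1) j' ++ t ∧ IsWordIn j' i W ∧ 1 ≤ j' ∧ j' ≤ j := by
  induction v generalizing p j with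
  | nil => exact absurd ((σ_dvd_descWord (by omega)).trans hd) (not_dvd_one _)
  | cons k v ih =>
    have hk := hv.1 _ ((σ_dvd_descWord (by omega)).trans hd)
    have hkp := hc.head
    have hk1 := hpos k (by simp)
    have hpos' : ∀ m ∈ v, 1 ≤ m := fun m hm => hpos m (by simp [hm])
    rcases Nat.lt_or_ge i k with h | h
    · obtain rfl : k = i + 1 := by omega
      obtain ⟨t, ht⟩ := exists_descWord_append (by omega) hv hc.tail hd
      exact ⟨[], j, t, ht, isWordIn_nil _ _, hj, le_rfl⟩
    rw [word_cons] at hd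
    -- As the preceding letter p is at least j, `CommFree` rules out k < j - 1. So a letter below j
    -- equals j - 1 and lowers j by one, while letters from j to i leave j unchanged.
    rcases Nat.lt_or_ge k j with h' | h'
    · obtain rfl : j = k + 1 := by omega
      obtain ⟨W, j', t, rfl, hW, hj1, hj2⟩ := ih hk1 le_rfl h hv.2 hc.tail hpos'
        (descWord_dvd_of_succ h hd)
      exact ⟨k :: W, j', t, rfl, isWordIn_cons.2 ⟨⟨hj2, h⟩, hW⟩, hj1, by omega⟩
    · obtain ⟨W, j', t, rfl, hW, hj1, hj2⟩ := ih hj h' h hv.2 hc.tail hpos'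
        (descWord_dvd h' h hd)
      exact ⟨k :: W, j', t, rfl, isWordIn_cons.2 ⟨⟨hj2.trans h', h⟩, hW⟩, hj1, by omega⟩

/-- The factor `V(1,i-1) W(j,i) a_{i+1,j}` of a minimal word divisible by `a_{i+1}`. -/
theorem exists_prefix_of_σ_dvd {i : ℕ} {v : List ℕ} (hi : 1 ≤ i) (hv : LexMin v) (hc : CommFree v)
    (hpos : ∀ m ∈ v, 1 ≤ m) (hd : σ (i + 1) ∣ word v) :
    ∃ V W j t, v = V ++ W ++ descWord (i + 1) j ++ t ∧ IsWordIn 1 (i - 1) V ∧ IsWordIn j i W ∧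
      (W = [] ∨ W.head? = some i) ∧ 1 ≤ j ∧ j ≤ i + 1 := by
  induction v with
  | nil => exact absurd hd (not_dvd_one _)
  | cons k v ih =>
    have hk := hv.1 _ hd
    have hk1 := hpos k (by simp)
    have hpos' : ∀ m ∈ v, 1 ≤ m := fun m hm => hpos m (by simp [hm])
    rcases Nat.lt_or_ge i k with h | h
    · obtain rfl : k = i + 1 := by omega
      exact ⟨[], [], i + 1, v, by simp, isWordIn_nil _ _, isWordIn_nil _ _, Or.inl rfl, by omega,
        le_rfl⟩
    obtain ⟨y, hy⟩ := hd
    rw [word_cons] at hy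
    -- Letters below i commute with `σ (i + 1)` and go into V; the first letter i opens W and leaves
    -- a remainder divisible by a_{i+1,i}.
    rcases h.eq_or_lt with rfl | h
    · obtain ⟨z, hz, -⟩ := (lcmForm_of_eq hy).of_adj (Or.inl rfl)
      obtain ⟨W, j', t, rfl, hW, hj1, hj2⟩ := exists_append_descWord hi le_rfl le_rfl hv.2 hc hpos'
        ⟨z, by rw [hz, descWord_succ (by omega)]; simp [mul_assoc]⟩
      exact ⟨[], k :: W, j', t, rfl, isWordIn_nil _ _, isWordIn_cons.2 ⟨⟨hj2, le_rfl⟩, hW⟩,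
        Or.inr rfl, hj1, by omega⟩
    · obtain ⟨z, hz, -⟩ := (lcmForm_of_eq hy).of_far (Or.inl (by omega))
      obtain ⟨V, W, j, t, rfl, hV, hW, hWi, hj1, hj2⟩ := ih hv.2 hc.tail hpos' ⟨z, hz⟩
      exact ⟨k :: V, W, j, t, rfl, isWordIn_cons.2 ⟨⟨hk1, by omega⟩, hV⟩, hW, hWi, hj1, hj2⟩

/-! ### Words avoiding the commutation and braid rules are minimal -/

/-- The word does not contain the left side of a braid relation of the rewriting system. -/
def BraidFree (l : List ℕ) : Prop :=
  ∀ i j V W, 1 ≤ i → 1 ≤ j → j ≤ i + 1 → IsWordIn 1 (i - 1) V → IsWordIn j i W →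
    (W = [] ∨ W.head? = some i) → ¬ [i + 1, i] ++ V ++ W ++ descWord (i + 1) j <:+: l

theorem BraidFree.tail {k : ℕ} {l : List ℕ} (h : BraidFree (k :: l)) : BraidFree l :=
  fun i j V W hi hj hji hV hW hWi hl => h i j V W hi hj hji hV hW hWi (List.infix_cons hl)

/-- The transfer of an equation between positive braids to a monoid with generators that satisfy
the braid relations. -/
theorem evalWord_eq_of_word_eq {M : Type*} [Monoid M] {n : ℕ} (g : Set.Icc 1 n → M)
    (hb : ∀ i j : Set.Icc 1 n, j.1 = i.1 + 1 → g j * g i * g j = g i * g j * g i)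
    (hc : ∀ m s : Set.Icc 1 n, s.1 + 1 < m.1 → g m * g s = g s * g m)
    {l l' : List ℕ} (h : word l = word l') :
    (IsWordIn 1 n l ↔ IsWordIn 1 n l') ∧
      (IsWordIn 1 n l → evalWord g l = evalWord g l') := by
  have hr : ConGen.Rel PosBraidRel (FreeMonoid.ofList l) (FreeMonoid.ofList l') := by
    refine PresentedMonoid.mk_eq_mk_iff.1 ?_
    rw [mk_eq_word, mk_eq_word]
    exact h
  have key : ∀ u v : FreeMonoid ℕ, ConGen.Rel PosBraidRel u v →
      (IsWordIn 1 n u.toList ↔ IsWordIn 1 n v.toList) ∧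
      (IsWordIn 1 n u.toList → evalWord g u.toList = evalWord g v.toList) := by
    intro u v h
    induction h with
    | of u v h =>
      rcases h with ⟨i⟩ | ⟨i, j, h⟩
      · have hbi : ∀ h1 h2, g ⟨i + 1, h1⟩ * (g ⟨i, h2⟩ * g ⟨i + 1, h1⟩) =
            g ⟨i, h2⟩ * (g ⟨i + 1, h1⟩ * g ⟨i, h2⟩) := fun h1 h2 => by
          simpa [mul_assoc] using hb ⟨i, h2⟩ ⟨i + 1, h1⟩ rfl
        simp only [FreeMonoid.toList_mul, FreeMonoid.toList_of, List.cons_append, List.nil_append,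
          isWordIn_cons]
        refine ⟨by tauto, fun hw => ?_⟩
        simp only [evalWord, List.map_cons, List.map_nil, List.prod_cons, List.prod_nil, mul_one]
        rw [dif_pos (by omega), dif_pos (by omega)]
        exact hbi _ _
      · have hbi : ∀ h1 h2, g ⟨j, h1⟩ * g ⟨i, h2⟩ = g ⟨i, h2⟩ * g ⟨j, h1⟩ := fun h1 h2 =>
          hc ⟨j, h1⟩ ⟨i, h2⟩ (by simp; omega)
        simp only [FreeMonoid.toList_mul, FreeMonoid.toList_of, List.cons_append, List.nil_append,
          isWordIn_cons]
        refine ⟨by tauto, fun hw => ?_⟩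
        simp only [evalWord, List.map_cons, List.map_nil, List.prod_cons, List.prod_nil, mul_one]
        rw [dif_pos (by omega), dif_pos (by omega)]
        exact hbi _ _
    | refl u => exact ⟨Iff.rfl, fun _ => rfl⟩
    | symm _ ih => exact ⟨ih.1.symm, fun h => (ih.2 (ih.1.2 h)).symm⟩
    | trans _ _ ih ih' => exact ⟨ih.1.trans ih'.1, fun h => (ih.2 h).trans (ih'.2 (ih.1.1 h))⟩
    | mul _ _ ih ih' =>
      simp only [FreeMonoid.toList_mul, isWordIn_append]
      refine ⟨and_congr ih.1 ih'.1, fun h => ?_⟩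
      simp only [evalWord, List.map_append, List.prod_append]
      exact congrArg₂ _ (ih.2 h.1) (ih'.2 h.2)
  exact key _ _ hr

/-- Braid relations preserve the set of letters; only that half of the transfer is used, so the
trivial monoid suffices as target. -/
theorem isWordIn_of_word_eq {n : ℕ} {l l' : List ℕ} (h : word l = word l') (hl : IsWordIn 1 n l) :
    IsWordIn 1 n l' :=
  (evalWord_eq_of_word_eq (M := Unit) (fun _ => ()) (fun _ _ _ => rfl) (fun _ _ _ => rfl) h).1.1 hl

theorem mem_of_σ_dvd {n m : ℕ} {l : List ℕ} (hl : IsWordIn 1 n l) (h : σ m ∣ word l) :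
    1 ≤ m ∧ m ≤ n := by
  obtain ⟨y, hy⟩ := h
  obtain ⟨l', rfl⟩ := exists_word y
  exact isWordIn_of_word_eq (l' := m :: l') (by simpa using hy) hl m (by simp)

/-- Suppose `σ m` divides a :: t with m < a. Garside's lemma makes `σ m` divide t, so t begins with
a letter at most m. If a ≥ m + 2, this gives a forbidden commuting descent; if a = m + 1, the word
begins with a_{m+1} a_m and `exists_prefix_of_σ_dvd` completes the left side of a braid rule. -/
theorem lexMin_of_braidFree {n : ℕ} {l : List ℕ} (hl : IsWordIn 1 n l) (hc : CommFree l)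
    (hb : BraidFree l) : LexMin l := by
  induction l with
  | nil => trivial
  | cons a t ih =>
    have ht := ih (isWordIn_cons.1 hl).2 hc.tail hb.tail
    refine ⟨fun m hm => ?_, ht⟩
    have hm1 := (mem_of_σ_dvd hl hm).1
    by_contra hma
    obtain ⟨y, hy⟩ := hm
    rw [word_cons] at hy
    by_cases h : m + 2 ≤ a
    · obtain ⟨z, hz, -⟩ := (lcmForm_of_eq hy).of_far (Or.inr h)
      cases t with
      | nil => exact not_dvd_one m ⟨z, hz⟩
      | cons k t =>
        have := ht.1 m ⟨z, hz⟩
        have := hc.head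
        omega
    · obtain rfl : a = m + 1 := by omega
      obtain ⟨z, hz, -⟩ := (lcmForm_of_eq hy).of_adj (Or.inr rfl)
      cases t with
      | nil => exact not_dvd_one m ⟨_, hz⟩
      | cons k t =>
        have := ht.1 m ⟨_, hz⟩
        have := hc.head
        obtain rfl : k = m := by omega
        obtain ⟨V, W, j, t', rfl, hV, hW, hWi, hj1, hj2⟩ := exists_prefix_of_σ_dvd (i := k) hm1 ht.2
          hc.tail.tail (fun m hm => (hl m (by simp [hm])).1) ⟨z, σ_mul_cancel hz⟩
        exact hb k j V W hm1 hj1 hj2 hV hW hWi ⟨[], t', by simp⟩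

theorem LexMin.eq_of_word_eq {l l' : List ℕ} (hl : LexMin l) (hl' : LexMin l')
    (h : word l = word l') : l = l' := by
  induction l generalizing l' with
  | nil =>
    cases l' with
    | nil => rfl
    | cons b t => exact absurd ⟨word t, by simpa using h⟩ (not_dvd_one b)
  | cons a t ih =>
    cases l' with
    | nil => exact absurd ⟨word t, by simpa using h.symm⟩ (not_dvd_one a)
    | cons b t' =>
      have h1 := hl.1 b ⟨word t', by rw [h, word_cons]⟩
      have h2 := hl'.1 a ⟨word t, by rw [← h, word_cons]⟩
      obtain rfl : a = b := by omega
      rw [ih hl.2 hl'.2 (σ_mul_cancel (i := a) (by simpa using h))]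

/-! ### Minimal words divisible by the Garside element -/

theorem lambdaWord_dvd_leftWord (V : ℕ → List ℕ) (i d : ℕ) :
    word (lambdaWord i) ∣ word (leftWord V i d) := by
  cases d with
  | zero => exact dvd_rfl
  | succ d => rw [leftWord, word_append, word_append, mul_assoc]; exact dvd_mul_right _ _

/-- Divisibility by `σ i` bounds the first letter by i, and by `leftWord_dvd` the letters below i
can be stripped without losing divisibility. -/
theorem exists_append_cons {i d : ℕ} {v : List ℕ} (hi : 1 ≤ i) (hv : LexMin v) (hc : CommFree v)
    (hpos : ∀ m ∈ v, 1 ≤ m) (hd : word (leftWord (fun _ => []) i d) ∣ word v) :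
    ∃ U v', v = U ++ i :: v' ∧ IsWordIn 1 (i - 1) U ∧ LexMin (i :: v') ∧ CommFree (i :: v') ∧
      word (leftWord (fun _ => []) i d) ∣ word (i :: v') := by
  have hσ : σ i ∣ word v := by
    obtain ⟨i, rfl⟩ := Nat.exists_eq_add_of_le' hi
    exact (σ_dvd_descWord (by omega)).trans ((lambdaWord_dvd_leftWord _ _ d).trans hd)
  induction v with
  | nil => exact absurd hσ (not_dvd_one i)
  | cons k v ih =>
    have hk := hv.1 i hσ
    have hk1 := hpos k (by simp)
    rcases hk.eq_or_lt with rfl | hk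
    · exact ⟨[], v, rfl, isWordIn_nil _ _, hv, hc, hd⟩
    · rw [word_cons] at hd
      have hd' := leftWord_dvd hk1 hk hd
      have hσ' : σ i ∣ word v := by
        obtain ⟨i, rfl⟩ := Nat.exists_eq_add_of_le' hi
        exact (σ_dvd_descWord (by omega)).trans ((lambdaWord_dvd_leftWord _ _ d).trans hd')
      obtain ⟨U, v', rfl, hU, h⟩ := ih hv.2 hc.tail (fun m hm => hpos m (by simp [hm])) hd' hσ'
      exact ⟨k :: U, v', rfl, isWordIn_cons.2 ⟨⟨hk1, by omega⟩, hU⟩, h⟩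

theorem LexMin.of_append {l m : List ℕ} (h : LexMin (l ++ m)) : LexMin m := by
  induction l with
  | nil => exact h
  | cons a l ih => exact ih h.2

theorem CommFree.of_append {l m : List ℕ} (h : CommFree (l ++ m)) : CommFree m :=
  fun s k hs hi => h s k hs (hi.trans (List.suffix_append l m).isInfix)

theorem exists_leftWord_append {i d : ℕ} {v : List ℕ} (hi : 1 ≤ i) (hv : LexMin v)
    (hc : CommFree v) (hpos : ∀ m ∈ v, 1 ≤ m)
    (hd : word (leftWord (fun _ => []) i d) ∣ word v) :
    ∃ U V t, IsWordIn 1 (i - 1) U ∧ (∀ m, i ≤ m → m < i + d → IsWordIn 1 m (V m)) ∧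
      v = U ++ leftWord V i d ++ t := by
  induction d generalizing i v with
  | zero =>
    obtain ⟨U, v', rfl, hU, hv', hc', hd'⟩ := exists_append_cons hi hv hc hpos hd
    obtain ⟨t, ht⟩ := exists_descWord_append hi hv' hc' hd'
    exact ⟨U, fun _ => [], t, hU, fun m _ _ => isWordIn_nil _ _, by rw [ht, List.append_assoc]; rfl⟩
  | succ d ih =>
    obtain ⟨U, v', rfl, hU, hv', hc', hd'⟩ := exists_append_cons hi hv hc hpos hd
    obtain ⟨t, ht⟩ := exists_descWord_append hi hv' hc'
      ((lambdaWord_dvd_leftWord _ _ _).trans hd')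
    rw [ht] at hv' hc' hd' hpos ⊢
    rw [leftWord, List.append_nil, word_append, word_append, lambdaWord] at hd'
    obtain ⟨y, hy⟩ := hd'
    rw [mul_assoc] at hy
    obtain ⟨U', V, t', hU', hV, rfl⟩ := ih (i := i + 1) (by omega) hv'.of_append hc'.of_append
      (fun m hm => hpos m (by simp [hm])) ⟨y, mul_left_cancel hy⟩
    -- The prefix U' that remains before Λ_{i+1} is the word V_i.
    refine ⟨U, Function.update V i U', t', hU, fun m hm hm' => ?_, ?_⟩
    · rcases hm.eq_or_lt with rfl | hm
      · simpa using hU'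
      · rw [Function.update_of_ne (by omega)]
        exact hV m hm (by omega)
    · rw [leftWord, leftWord_congr (V := Function.update V i U') (V' := V) fun m hm =>
        Function.update_of_ne (by omega) _ _]
      simp [lambdaWord]

/-- A minimal word that is divisible by the Garside element begins with the left side of a Garside
relation of the rewriting system. -/
theorem exists_garsideLeft_append {n : ℕ} {v : List ℕ} (hn : 1 ≤ n) (hv : LexMin v)
    (hc : CommFree v) (hpos : ∀ m ∈ v, 1 ≤ m) (hd : delta n ∣ word v) :
    ∃ V t, (∀ i, 1 ≤ i → i ≤ n - 1 → IsWordIn 1 i (V i)) ∧ v = garsideLeft n V ++ t := by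
  rw [delta, garsideWord_eq hn] at hd
  obtain ⟨U, V, t, hU, hV, rfl⟩ := exists_leftWord_append le_rfl hv hc hpos hd
  obtain rfl : U = [] := List.eq_nil_iff_forall_not_mem.2 fun m hm => by
    have := hU m hm
    omega
  exact ⟨V, t, fun i hi hi' => hV i hi (by omega), by rw [garsideLeft_eq hn]; rfl⟩

end PosBraid

namespace PosBraid

/-! ### The embedding of positive braids into the braid group -/

/-- The reversal of positive braids. -/
def revHom : PosBraid →* PosBraidᵐᵒᵖ :=
  PresentedMonoid.lift (fun i => MulOpposite.op (σ i)) (by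
    rintro _ _ (⟨i⟩ | ⟨i, j, h⟩)
    · simpa [← MulOpposite.op_mul] using braid (Or.inr rfl : Adj (i + 1) i)
    · simpa [← MulOpposite.op_mul] using comm (Or.inl h : Far i j))

theorem revHom_word (l : List ℕ) : revHom (word l) = MulOpposite.op (word l.reverse) := by
  induction l with
  | nil => simp
  | cons i l ih =>
    rw [word_cons, map_mul, ih, show revHom (σ i) = MulOpposite.op (σ i) from rfl]
    simp

theorem word_reverse_eq {l l' : List ℕ} (h : word l = word l') :
    word l.reverse = word l'.reverse := by
  have := congrArg revHom h
  rwa [revHom_word, revHom_word, MulOpposite.op_inj] at this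

instance : IsRightCancelMul PosBraid where
  mul_right_cancel z x y h := by
    obtain ⟨l, rfl⟩ := exists_word z
    obtain ⟨l₁, rfl⟩ := exists_word x
    obtain ⟨l₂, rfl⟩ := exists_word y
    have h' : word (l₁ ++ l) = word (l₂ ++ l) := by simpa using h
    have h' := word_reverse_eq h'
    simp only [List.reverse_append, word_append] at h'
    simpa using word_reverse_eq (mul_left_cancel h')

/-! ### Powers of the Garside element as common multiples -/

theorem exists_delta_mul_word {n : ℕ} (m : ℕ) {l : List ℕ} (hl : IsWordIn 1 n l) :
    ∃ l', IsWordIn 1 n l' ∧ delta n ^ m * word l = word l' * delta n ^ m := by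
  have h1 : ∀ l, IsWordIn 1 n l →
      ∃ l', IsWordIn 1 n l' ∧ delta n * word l = word l' * delta n := by
    intro l hl
    induction l with
    | nil => exact ⟨[], isWordIn_nil _ _, by simp⟩
    | cons i l ih =>
      rw [isWordIn_cons] at hl
      obtain ⟨l', hl', h⟩ := ih hl.2
      refine ⟨(n - i + 1) :: l', isWordIn_cons.2 ⟨by omega, hl'⟩, ?_⟩
      have hi := σ_mul_delta (n := n) (l := n - i + 1) (by omega) (by omega)
      rw [show n - (n - i + 1) + 1 = i by omega] at hi
      rw [word_cons, ← mul_assoc, ← hi, mul_assoc, h, word_cons, mul_assoc]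
  induction m with
  | zero => exact ⟨l, hl, by simp⟩
  | succ m ih =>
    obtain ⟨l', hl', h⟩ := ih
    obtain ⟨l'', hl'', h'⟩ := h1 l' hl'
    exact ⟨l'', hl'', by rw [pow_succ', mul_assoc, h, ← mul_assoc, h', mul_assoc]⟩

theorem exists_word_mul_eq_delta_pow {n : ℕ} {l : List ℕ} (hl : IsWordIn 1 n l) :
    ∃ y m, word y * word l = delta n ^ m := by
  induction l using List.reverseRecOn with
  | nil => exact ⟨[], 0, by simp⟩
  | append_singleton l i ih =>
    rw [isWordIn_append, isWordIn_cons] at hl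
    obtain ⟨y, m, h⟩ := ih hl.1
    obtain ⟨r, hr, h'⟩ := exists_delta_mul_word (n := n) m (l := [i])
      (isWordIn_cons.2 ⟨hl.2.1, isWordIn_nil _ _⟩)
    -- Comparing lengths shows that r is a single letter, so it divides Δ on the right; each letter
    -- of l thus costs one factor Δ.
    obtain ⟨z, hz⟩ : ∃ z, word z * word r = delta n := by
      have : r.length = 1 := by
        have := congrArg len h'
        simp only [len_mul, len_word, List.length_singleton] at this
        omega
      obtain ⟨k, rfl⟩ := List.length_eq_one_iff.1 this
      have hk := (isWordIn_cons.1 hr).1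
      obtain ⟨z, hz⟩ := exists_mul_σ_eq_delta hk.1 hk.2
      obtain ⟨z, rfl⟩ := exists_word z
      exact ⟨z, by simpa using hz⟩
    refine ⟨z ++ y, m + 1, ?_⟩
    rw [word_append, word_append, mul_assoc, ← mul_assoc (word y), h, h', ← mul_assoc, hz,
      pow_succ']

theorem exists_isWordIn (l : List ℕ) : ∃ n, IsWordIn 0 n l :=
  ⟨l.sum, fun _ hm => ⟨Nat.zero_le _, List.single_le_sum (fun _ _ => Nat.zero_le _) _ hm⟩⟩

/-- Words without the letter `0` that represent the same positive braid still do so after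
shifting all indices down. -/
theorem word_map_pred_eq {n : ℕ} {l l' : List ℕ} (h : word l = word l') (hl : IsWordIn 1 n l) :
    word (l.map Nat.pred) = word (l'.map Nat.pred) := by
  have key : ∀ {l}, IsWordIn 1 n l →
      evalWord (fun i : Set.Icc 1 n => σ (i.1 - 1)) l = word (l.map Nat.pred) := by
    intro l hl
    unfold evalWord word
    rw [List.map_map]
    refine congrArg _ (List.map_congr_left fun i hi => ?_)
    rw [dif_pos (hl i hi)]
    rfl
  rw [← key hl, ← key (isWordIn_of_word_eq h hl)]
  refine (evalWord_eq_of_word_eq _ ?_ ?_ h).2 hl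
  · rintro ⟨i, hi⟩ ⟨j, hj⟩ (rfl : j = i + 1)
    have : Adj (i + 1 - 1) (i - 1) := Or.inr (by have := hi.1; omega)
    simpa [mul_assoc] using braid this
  · rintro ⟨i, hi⟩ ⟨j, hj⟩ (h : j + 1 < i)
    have := hj.1
    exact comm (Or.inr (by simp; omega))

theorem exists_word_eq_delta_pow (n m : ℕ) :
    ∃ d, IsWordIn 1 n d ∧ word d = delta n ^ m := by
  induction m with
  | zero => exact ⟨[], isWordIn_nil _ _, by simp⟩
  | succ m ih =>
    obtain ⟨d, hd, h⟩ := ih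
    exact ⟨d ++ garsideWord n, isWordIn_append.2 ⟨hd, isWordIn_garsideWord n⟩, by
      rw [word_append, h, pow_succ, delta]⟩

/-- If r y = Δ^m and Δ^m x = s Δ^m, then Δ^m x = (s r) y. Since Δ involves only positive indices,
both words are shifted up first and the resulting equation is shifted back. -/
theorem exists_mul_eq_mul (x y : PosBraid) : ∃ x' y', y' * x = x' * y := by
  obtain ⟨l, rfl⟩ := exists_word x
  obtain ⟨l', rfl⟩ := exists_word y
  obtain ⟨n, hn⟩ := exists_isWordIn (l ++ l')
  have hn := hn.shift 1
  rw [show shiftWord 1 (l ++ l') = shiftWord 1 l ++ shiftWord 1 l' by simp [shiftWord],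
    isWordIn_append] at hn
  obtain ⟨r, m, hr⟩ := exists_word_mul_eq_delta_pow hn.2
  obtain ⟨s, hs, hs'⟩ := exists_delta_mul_word m hn.1
  obtain ⟨d, hd, hdm⟩ := exists_word_eq_delta_pow (n + 1) m
  have hp : ∀ l, (shiftWord 1 l).map Nat.pred = l := fun l => by simp [shiftWord, Function.comp_def]
  have h := word_map_pred_eq (l := d ++ shiftWord 1 l) (l' := s ++ r ++ shiftWord 1 l') (n := n + 1)
    (by simp only [word_append]; rw [hdm, hs', mul_assoc, hr]) (isWordIn_append.2 ⟨hd, hn.1⟩)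
  rw [List.map_append, List.map_append, hp, hp, word_append, word_append] at h
  exact ⟨_, _, h⟩

/-! ### The group of fractions -/

noncomputable instance : OreLocalization.OreSet (⊤ : Submonoid PosBraid) where
  ore_right_cancel _ _ s h := ⟨s, congrArg _ (mul_right_cancel h)⟩
  oreNum x y := (exists_mul_eq_mul x y).choose
  oreDenom x y := ⟨(exists_mul_eq_mul x y).choose_spec.choose, trivial⟩
  ore_eq x y := (exists_mul_eq_mul x y).choose_spec.choose_spec

/-- The group of fractions of the positive braid monoid. -/
abbrev Fractions : Type := OreLocalization (⊤ : Submonoid PosBraid) PosBraid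

theorem numeratorHom_injective :
    Function.Injective (OreLocalization.numeratorHom : PosBraid →* Fractions) := by
  intro x y h
  rw [OreLocalization.numeratorHom_apply, OreLocalization.numeratorHom_apply,
    OreLocalization.oreDiv_eq_iff] at h
  obtain ⟨u, v, h, h'⟩ := h
  simp only [OneMemClass.coe_one, mul_one] at h'
  rw [← h', Submonoid.smul_def, smul_eq_mul, smul_eq_mul] at h
  exact (mul_left_cancel h).symm

theorem artinGen_braid {n : ℕ} (i j : Set.Icc 1 n) (h : j.1 = i.1 + 1) :
    artinGen n j * artinGen n i * artinGen n j = artinGen n i * artinGen n j * artinGen n i :=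
  PresentedGroup.mk_eq_mk_of_mul_inv_mem (BraidRelator.braid i j h)

theorem artinGen_comm {n : ℕ} (m s : Set.Icc 1 n) (h : s.1 + 1 < m.1) :
    artinGen n m * artinGen n s = artinGen n s * artinGen n m :=
  PresentedGroup.mk_eq_mk_of_mul_inv_mem (BraidRelator.comm m s h)

/-- The homomorphism from the braid group to the group of fractions of the monoid of positive
braids. -/
noncomputable def toFractions (n : ℕ) : BraidGroup n →* Fractionsˣ :=
  PresentedGroup.toGroup
    (f := fun i : Set.Icc 1 n => OreLocalization.numeratorUnit
      (⟨σ i.1, trivial⟩ : (⊤ : Submonoid PosBraid))) (by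
    have hu : ∀ i, ((OreLocalization.numeratorUnit
        (⟨σ i, trivial⟩ : (⊤ : Submonoid PosBraid)) : Fractionsˣ) : Fractions) =
        OreLocalization.numeratorHom (σ i) := fun i => rfl
    rintro _ (⟨⟨i, hi⟩, ⟨j, hj⟩, rfl⟩ | ⟨⟨m, hm⟩, ⟨s, hs⟩, h⟩)
    · simp only [map_mul, map_inv, FreeGroup.lift_apply_of]
      rw [mul_inv_eq_one, Units.ext_iff]
      simp only [Units.val_mul, hu, ← map_mul, mul_assoc]
      rw [braid (Or.inr rfl)]
    · simp only [map_mul, map_inv, FreeGroup.lift_apply_of]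
      rw [mul_inv_eq_one, Units.ext_iff]
      simp only [Units.val_mul, hu, ← map_mul]
      rw [comm (Or.inr h)])

theorem toFractions_evalWord {n : ℕ} {l : List ℕ} (hl : IsWordIn 1 n l) :
    ((toFractions n (evalWord (artinGen n) l) : Fractionsˣ) : Fractions) =
      OreLocalization.numeratorHom (word l) := by
  induction l with
  | nil =>
    rw [show evalWord (artinGen n) [] = 1 from rfl, map_one, word_nil, map_one, Units.val_one]
  | cons i l ih =>
    rw [isWordIn_cons] at hl
    have h : evalWord (artinGen n) (i :: l) = artinGen n ⟨i, hl.1⟩ * evalWord (artinGen n) l := by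
      simp [evalWord, hl.1]
    rw [h, map_mul, Units.val_mul, ih hl.2, word_cons, map_mul]
    refine congrArg (· * _) ?_
    rw [toFractions, artinGen, PresentedGroup.toGroup.of]
    rfl

/-- Two positive words are equal in the braid group if and only if they represent the same
positive braid. -/
theorem evalWord_artinGen_eq_iff {n : ℕ} {l l' : List ℕ} (hl : IsWordIn 1 n l)
    (hl' : IsWordIn 1 n l') :
    evalWord (artinGen n) l = evalWord (artinGen n) l' ↔ word l = word l' := by
  refine ⟨fun h => numeratorHom_injective ?_, fun h =>
    (evalWord_eq_of_word_eq _ artinGen_braid artinGen_comm h).2 hl⟩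
  rw [← toFractions_evalWord hl, ← toFractions_evalWord hl', h]

end PosBraid

/-! ### The deg-lex order -/

theorem List.Lex.append_right_of_length_eq {X : Type*} {r : X → X → Prop} {s t : List X}
    (h : List.Lex r s t) (hl : s.length = t.length) (b : List X) :
    List.Lex r (s ++ b) (t ++ b) := by
  induction h with
  | nil => simp at hl
  | rel h => exact .rel h
  | cons _ ih => exact .cons (ih (by simpa using hl))

section DegLex

variable {X : Type*} [LinearOrder X]

theorem DegLexLT.trans {u v w : FreeMonoid X} (h : DegLexLT u v) (h' : DegLexLT v w) :
    DegLexLT u w := by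
  unfold DegLexLT at *
  rw [List.shortlex_def] at *
  rcases h with h | ⟨h, hl⟩ <;> rcases h' with h' | ⟨h', hl'⟩
  · exact Or.inl (h.trans h')
  · exact Or.inl (by omega)
  · exact Or.inl (by omega)
  · exact Or.inr ⟨h.trans h', lt_trans (α := List X) hl hl'⟩

theorem DegLexLT.irrefl (u : FreeMonoid X) : ¬ DegLexLT u u := by
  unfold DegLexLT
  rw [List.shortlex_def]
  rintro (h | ⟨-, h⟩)
  · omega
  · exact lt_irrefl (α := List X) _ h

theorem DegLexLT.mul_mul {u v : FreeMonoid X} (h : DegLexLT u v) (a b : FreeMonoid X) :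
    DegLexLT (a * u * b) (a * v * b) := by
  unfold DegLexLT at *
  rw [mul_assoc, mul_assoc, FreeMonoid.toList_mul, FreeMonoid.toList_mul]
  refine List.Shortlex.append_left ?_ _
  rw [List.shortlex_def] at *
  simp only [FreeMonoid.toList_mul, List.length_append, add_lt_add_iff_right, add_left_inj]
  rcases h with h | ⟨h, hl⟩
  · exact Or.inl h
  · exact Or.inr ⟨h, hl.append_right_of_length_eq h _⟩

theorem wellFounded_degLexLT [WellFoundedLT X] : WellFounded (DegLexLT (X := X)) :=
  InvImage.wf FreeMonoid.toList (List.Shortlex.wf wellFounded_lt)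

end DegLex

/-! ### Rewriting -/

section Rewriting

variable {X : Type*} (R : FreeMonoid X → FreeMonoid X → Prop)

/-- One rewriting step. -/
def RewriteStep (x y : FreeMonoid X) : Prop :=
  ∃ a u v b, R u v ∧ x = a * u * b ∧ y = a * v * b

/-- A word to which no rewriting rule applies. -/
def IsIrreducibleWord (x : FreeMonoid X) : Prop := ∀ a u v b, R u v → x ≠ a * u * b

variable {R}

theorem map_eq_of_rewrite {M : Type*} [Monoid M] (f : FreeMonoid X →* M)
    (hf : ∀ u v, R u v → f u = f v) {x y : FreeMonoid X}
    (h : Relation.ReflTransGen (RewriteStep R) x y) : f x = f y := by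
  induction h with
  | refl => rfl
  | tail _ h ih =>
    obtain ⟨a, u, v, b, h, rfl, rfl⟩ := h
    rw [ih, map_mul, map_mul, map_mul, map_mul, hf u v h]

variable {k : Type*} [Field k]

open Classical in
theorem coeff_monom_sub (u v w : FreeMonoid X) :
    (monom k u - monom k v).coeff w = (if w = u then 1 else 0) - if w = v then 1 else 0 := by
  simp [monom, MonoidAlgebra.of, MonoidAlgebra.coeff_sub, MonoidAlgebra.coeff_single,
    Finsupp.single_apply, eq_comm]

variable [LinearOrder X]

theorem exists_isIrreducibleWord [WellFoundedLT X] (hR : ∀ u v, R u v → DegLexLT v u)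
    (x : FreeMonoid X) :
    ∃ y, Relation.ReflTransGen (RewriteStep R) x y ∧ IsIrreducibleWord R y := by
  refine wellFounded_degLexLT.induction (C := fun x =>
    ∃ y, Relation.ReflTransGen (RewriteStep R) x y ∧ IsIrreducibleWord R y) x fun x ih => ?_
  by_cases hx : IsIrreducibleWord R x
  · exact ⟨x, .refl, hx⟩
  · simp only [IsIrreducibleWord, not_forall, not_not] at hx
    obtain ⟨a, u, v, b, h, rfl⟩ := hx
    obtain ⟨y, hy, hy'⟩ := ih _ ((hR u v h).mul_mul a b)
    exact ⟨y, .head ⟨a, u, v, b, h, rfl, rfl⟩ hy, hy'⟩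

theorem monicWithLeadingWord_sub {u v : FreeMonoid X} (h : DegLexLT v u) :
    MonicWithLeadingWord (monom k u - monom k v) u := by
  have hne : u ≠ v := by rintro rfl; exact DegLexLT.irrefl _ h
  refine ⟨by rw [coeff_monom_sub]; simp [hne], fun w hw => ?_⟩
  rw [coeff_monom_sub] at hw
  by_cases h1 : w = u
  · exact Or.inl h1
  · by_cases h2 : w = v
    · exact Or.inr (h2 ▸ h)
    · simp [h1, h2] at hw

theorem MonicWithLeadingWord.unique {f : FreeAssoc k X} {u u' : FreeMonoid X}
    (h : MonicWithLeadingWord f u) (h' : MonicWithLeadingWord f u') : u = u' := by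
  rcases h.2 u' (by rw [h'.1]; exact one_ne_zero) with rfl | h1
  · rfl
  · rcases h'.2 u (by rw [h.1]; exact one_ne_zero) with rfl | h2
    · rfl
    · exact absurd (h1.trans h2) (DegLexLT.irrefl _)

/-- The difference telescopes over the steps; the leading word of each summand is the word before
that step, which is still below w. -/
theorem trivialMod_of_rewrite (hR : ∀ u v, R u v → DegLexLT v u) {w x y : FreeMonoid X}
    (hx : DegLexLT x w) (h : Relation.ReflTransGen (RewriteStep R) x y) :
    DegLexLT y w ∧ TrivialMod (relationPolynomials k R) w (monom k x - monom k y) := by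
  induction h with
  | refl => exact ⟨hx, by rw [sub_self]; exact Submodule.zero_mem _⟩
  | tail _ h ih =>
    obtain ⟨a, u, v, b, h, rfl, rfl⟩ := h
    refine ⟨((hR u v h).mul_mul a b).trans ih.1, ?_⟩
    have hs : monom k (a * u * b) - monom k (a * v * b) =
        monom k a * (monom k u - monom k v) * monom k b := by
      simp only [monom, map_mul, mul_sub, sub_mul]
    rw [← sub_add_sub_cancel _ (monom k (a * u * b)), hs]
    exact Submodule.add_mem _ ih.2 (Submodule.subset_span
      ⟨_, ⟨u, v, h, rfl⟩, u, a, b, monicWithLeadingWord_sub (hR u v h), ih.1, rfl⟩)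

/-- If the rules of a terminating rewriting system hold in a monoid, in which distinct reduced words
have distinct images, then the corresponding polynomials form a Gröbner–Shirshov set. -/
theorem isGroebnerShirshov_relationPolynomials [WellFoundedLT X]
    (hR : ∀ u v, R u v → DegLexLT v u) {M : Type*} [Monoid M] (f : FreeMonoid X →* M)
    (hf : ∀ u v, R u v → f u = f v)
    (huniq : ∀ x y, IsIrreducibleWord R x → IsIrreducibleWord R y → f x = f y → x = y) :
    IsGroebnerShirshov (relationPolynomials k R) := by
  have key : ∀ w x y, DegLexLT x w → DegLexLT y w → f x = f y →
      TrivialMod (relationPolynomials k R) w (monom k x - monom k y) := by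
    intro w x y hx hy hxy
    obtain ⟨x', hx', hx''⟩ := exists_isIrreducibleWord hR x
    obtain ⟨y', hy', hy''⟩ := exists_isIrreducibleWord hR y
    obtain rfl : x' = y' := huniq _ _ hx'' hy'' (by
      rw [← map_eq_of_rewrite f hf hx', ← map_eq_of_rewrite f hf hy', hxy])
    rw [← sub_sub_sub_cancel_right _ _ (monom k x')]
    exact Submodule.sub_mem _ (trivialMod_of_rewrite hR hx hx').2
      (trivialMod_of_rewrite hR hy hy').2
  refine ⟨?_, ?_, ?_⟩
  · rintro _ ⟨u, v, h, rfl⟩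
    exact ⟨u, monicWithLeadingWord_sub (hR u v h)⟩
  · rintro _ ⟨u, v, h, rfl⟩ _ ⟨u', v', h', rfl⟩ p q a b w hp hq rfl hw -
    obtain rfl := hp.unique (monicWithLeadingWord_sub (hR u v h))
    obtain rfl := hq.unique (monicWithLeadingWord_sub (hR u' v' h'))
    -- The two copies of w cancel, leaving two smaller words with the same image.
    have hs : (monom k p - monom k v) * monom k b - monom k a * (monom k q - monom k v') =
        monom k (a * v') - monom k (v * b) := by
      simp only [mul_sub, sub_mul, monom, ← map_mul, hw]
      abel
    rw [hs]
    refine key _ _ _ ?_ ?_ ?_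
    · rw [hw]; simpa using (hR _ _ h').mul_mul a 1
    · simpa using (hR _ _ h).mul_mul 1 b
    · rw [map_mul, ← hf _ _ h', ← map_mul, ← hw, map_mul, hf _ _ h, map_mul]
  · rintro _ ⟨u, v, h, rfl⟩ _ ⟨u', v', h', rfl⟩ p q a b w hp hq rfl hw
    obtain rfl := hp.unique (monicWithLeadingWord_sub (hR u v h))
    obtain rfl := hq.unique (monicWithLeadingWord_sub (hR u' v' h'))
    have hs : (monom k w - monom k v) - monom k a * (monom k q - monom k v') * monom k b =
        monom k (a * v' * b) - monom k v := by
      simp only [mul_sub, sub_mul, monom, ← map_mul, hw]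
      abel
    rw [hs]
    refine key _ _ _ ?_ ?_ ?_
    · rw [hw]; exact (hR _ _ h').mul_mul a b
    · exact hR _ _ h
    · rw [map_mul, map_mul, ← hf _ _ h', ← map_mul, ← map_mul, ← hw, hf _ _ h]

end Rewriting

/-! ### The rewriting system in the Artin–Garside generators -/

namespace ArtinGarside

open PosBraid

variable {n : ℕ}

theorem evalWord_append {M : Type*} [Monoid M] (g : Set.Icc 1 n → M) (l m : List ℕ) :
    evalWord g (l ++ m) = evalWord g l * evalWord g m := by
  simp [evalWord]

theorem evalWord_singleton {M : Type*} [Monoid M] (g : Set.Icc 1 n → M) {i : ℕ}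
    (h : 1 ≤ i ∧ i ≤ n) : evalWord g [i] = g ⟨i, h⟩ := by
  simp [evalWord, h.1, h.2]

theorem map_evalWord {M N : Type*} [Monoid M] [Monoid N] (f : M →* N) (g : Set.Icc 1 n → M)
    (l : List ℕ) : f (evalWord g l) = evalWord (fun i => f (g i)) l := by
  induction l with
  | nil => simp [evalWord]
  | cons i l ih =>
    rw [← List.singleton_append, evalWord_append, evalWord_append, map_mul, ih]
    refine congrArg (· * _) ?_
    by_cases h : 1 ≤ i ∧ i ≤ n
    · rw [evalWord_singleton _ h, evalWord_singleton _ h]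
    · simp [evalWord, h]

/-! ### The rules hold in the braid group -/

/-- The element of the braid group denoted by a word in the Artin–Garside generators. -/
def toBraid (n : ℕ) : FreeMonoid (AGLetter n) →* BraidGroup n := FreeMonoid.lift AGLetter.toBraid

@[simp] theorem toBraid_wArtin (l : List ℕ) : toBraid n (wArtin n l) = evalWord (artinGen n) l := by
  rw [wArtin, map_evalWord]
  rfl

@[simp] theorem toBraid_wDelta : toBraid n (wDelta n) = garsideElement n := rfl

@[simp] theorem toBraid_wDeltaInv : toBraid n (wDeltaInv n) = (garsideElement n)⁻¹ := rfl

theorem evalWord_artinGen_eq {l l' : List ℕ} (hl : IsWordIn 1 n l) (h : word l = word l') :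
    evalWord (artinGen n) l = evalWord (artinGen n) l' :=
  (evalWord_artinGen_eq_iff hl (isWordIn_of_word_eq h hl)).2 h

theorem artin_mul_garsideElement {l : ℕ} (hl : 1 ≤ l) (hln : l ≤ n) :
    evalWord (artinGen n) [l] * garsideElement n =
      garsideElement n * evalWord (artinGen n) [n - l + 1] := by
  rw [garsideElement, ← evalWord_append, ← evalWord_append]
  refine evalWord_artinGen_eq (isWordIn_append.2
    ⟨isWordIn_cons.2 ⟨⟨hl, hln⟩, isWordIn_nil _ _⟩, isWordIn_garsideWord n⟩) ?_
  simpa [PosBraid.delta] using σ_mul_delta hl hln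

theorem isWordIn_braid {i j : ℕ} {V W : List ℕ} (hi : 1 ≤ i) (hin : i + 1 ≤ n)
    (hj : 1 ≤ j) (hV : IsWordIn 1 (i - 1) V) (hW : IsWordIn j i W) :
    IsWordIn 1 n ([i + 1, i] ++ V ++ W ++ descWord (i + 1) j) := by
  simp only [isWordIn_append, isWordIn_cons]
  exact ⟨⟨⟨⟨by omega, by omega, isWordIn_nil _ _⟩, hV.mono le_rfl (by omega)⟩,
    hW.mono hj (by omega)⟩, (isWordIn_descWord _ _).mono hj hin⟩

theorem isWordIn_garsideLeft (hn : 1 ≤ n) {V : ℕ → List ℕ}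
    (hV : ∀ i, 1 ≤ i → i ≤ n - 1 → IsWordIn 1 i (V i)) : IsWordIn 1 n (garsideLeft n V) := by
  rw [garsideLeft_eq hn]
  exact isWordIn_leftWord (by omega) fun m hm hm' => hV m hm (by omega)

theorem toBraid_eq (hn : 1 ≤ n) {u v : FreeMonoid (AGLetter n)} (h : AGRelation n u v) :
    toBraid n u = toBraid n v := by
  rcases h with ⟨i, j, V, W, hi, hin, hj, hji, hV, hW, hWi⟩ | ⟨s, m, hm, hs, hms⟩ | ⟨V, hV⟩ |
    ⟨l, hl, hln⟩ | ⟨l, hl, hln⟩ | _ | _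
  · rw [toBraid_wArtin, toBraid_wArtin]
    exact evalWord_artinGen_eq (isWordIn_braid hi hin hj hV hW) (braid_relation hi hji hV hW)
  · rw [toBraid_wArtin, toBraid_wArtin]
    refine evalWord_artinGen_eq ?_ (by simpa using PosBraid.comm (Or.inr hms))
    simp only [isWordIn_cons]
    exact ⟨by omega, by omega, isWordIn_nil _ _⟩
  · rw [toBraid_wArtin, map_mul, toBraid_wArtin, toBraid_wDelta, garsideElement, ← evalWord_append]
    refine evalWord_artinGen_eq (isWordIn_garsideLeft hn hV) ?_
    rw [garside_relation hn hV, word_append, PosBraid.delta]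
  · rw [map_mul, map_mul, toBraid_wArtin, toBraid_wArtin, toBraid_wDelta,
      artin_mul_garsideElement hl hln]
  · have h := artin_mul_garsideElement (n := n) (l := n - l + 1) (by omega) (by omega)
    rw [show n - (n - l + 1) + 1 = l by omega] at h
    rw [map_mul, map_mul, toBraid_wArtin, toBraid_wArtin, toBraid_wDeltaInv, eq_inv_mul_iff_mul_eq,
      ← mul_assoc, ← h, mul_inv_cancel_right]
  · simp
  · simp

/-! ### The rules decrease the deg-lex order -/

theorem isWordIn_singleton {l : ℕ} (hl : 1 ≤ l) (hln : l ≤ n) : IsWordIn 1 n [l] :=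
  isWordIn_cons.2 ⟨⟨hl, hln⟩, isWordIn_nil _ _⟩

theorem wArtin_append (l m : List ℕ) : wArtin n (l ++ m) = wArtin n l * wArtin n m :=
  evalWord_append _ l m

theorem toList_wArtin_cons {i : ℕ} (h : 1 ≤ i ∧ i ≤ n) (l : List ℕ) :
    (wArtin n (i :: l)).toList = AGLetter.a ⟨i, h⟩ :: (wArtin n l).toList := by
  rw [← List.singleton_append, wArtin_append, wArtin, evalWord_singleton _ h]
  rfl

theorem length_wArtin {l : List ℕ} (hl : IsWordIn 1 n l) :
    (wArtin n l).toList.length = l.length := by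
  induction l with
  | nil => rfl
  | cons i l ih =>
    rw [isWordIn_cons] at hl
    rw [toList_wArtin_cons hl.1, List.length_cons, List.length_cons, ih hl.2]

theorem degLexLT_of_cons {x y : AGLetter n} {p q : FreeMonoid (AGLetter n)}
    {u v : List (AGLetter n)} (hp : p.toList = x :: u) (hq : q.toList = y :: v)
    (hl : p.toList.length ≤ q.toList.length) (h : x.rank < y.rank) : DegLexLT p q := by
  unfold DegLexLT
  rw [List.shortlex_def]
  rcases hl.lt_or_eq with hl | hl
  · exact Or.inl hl
  · exact Or.inr ⟨hl, by rw [hp, hq]; exact .rel h⟩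

theorem length_leftWord (V : ℕ → List ℕ) {i : ℕ} (hi : 1 ≤ i) (d : ℕ) :
    (rightWord V i d).length + 1 ≤ (leftWord V i d).length := by
  have h : ∀ i, (lambdaWord i).length = i := fun i => by simp [lambdaWord, descWord]
  induction d generalizing i with
  | zero => simpa [leftWord, rightWord, h] using hi
  | succ d ih =>
    have := ih (i := i + 1) (by omega)
    simp only [leftWord, rightWord, List.length_append, shiftWord, List.length_map]
    omega

theorem exists_leftWord_eq_cons (V : ℕ → List ℕ) {i : ℕ} (hi : 1 ≤ i) (d : ℕ) :
    ∃ t, leftWord V i d = i :: t := by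
  obtain ⟨i, rfl⟩ := Nat.exists_eq_add_of_le' hi
  cases d with
  | zero => exact ⟨_, by rw [leftWord, lambdaWord, descWord_succ (by omega)]⟩
  | succ d => exact ⟨_, by rw [leftWord, lambdaWord, descWord_succ (by omega)]; rfl⟩

theorem isWordIn_garsideRight (hn : 1 ≤ n) {V : ℕ → List ℕ}
    (hV : ∀ i, 1 ≤ i → i ≤ n - 1 → IsWordIn 1 i (V i)) : IsWordIn 1 n (garsideRight n V) := by
  rw [garsideRight_eq]
  exact isWordIn_rightWord (by omega) fun m hm hm' => hV m hm (by omega)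

/-- The two inverse rules shorten the word; all others lower the first letter without increasing the
length. For n = 0 the Garside rule would read 1 = Δ and lengthen it. -/
theorem degLexLT (hn : 1 ≤ n) {u v : FreeMonoid (AGLetter n)} (h : AGRelation n u v) :
    DegLexLT v u := by
  rcases h with ⟨i, j, V, W, hi, hin, hj, hji, hV, hW, hWi⟩ | ⟨s, m, hm, hs, hms⟩ | ⟨V, hV⟩ |
    ⟨l, hl, hln⟩ | ⟨l, hl, hln⟩ | _ | _
  · have h1 := isWordIn_braid hi hin hj hV hW
    have h2 := isWordIn_of_word_eq (braid_relation hi hji hV hW) h1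
    have h3 := length_wArtin h1
    have h4 := length_wArtin h2
    simp only [List.cons_append, List.nil_append, isWordIn_cons] at h1 h2 h3 h4 ⊢
    refine degLexLT_of_cons (toList_wArtin_cons h2.1 _) (toList_wArtin_cons h1.1 _) ?_
      (by simp [AGLetter.rank])
    rw [h3, h4]
    have h5 : (descWord (i + 1) j).length = (descWord i j).length + 1 := by
      rw [descWord_succ hji, List.length_cons]
    have h6 : (shiftWord 1 W).length = W.length := by simp [shiftWord]
    simp only [List.length_cons, List.length_append]
    omega
  · refine degLexLT_of_cons (toList_wArtin_cons ⟨hm, by omega⟩ _)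
      (toList_wArtin_cons ⟨by omega, hs⟩ _) ?_ (by simp [AGLetter.rank]; omega)
    rw [length_wArtin, length_wArtin]
    · simp
    all_goals
      simp only [isWordIn_cons]
      exact ⟨by omega, by omega, isWordIn_nil _ _⟩
  · have h1 := isWordIn_garsideLeft hn hV
    obtain ⟨t, ht⟩ := exists_leftWord_eq_cons V le_rfl (n - 1)
    have h2 := length_leftWord V le_rfl (n - 1)
    have h3 := length_wArtin (isWordIn_garsideRight hn hV)
    have h4 := length_wArtin h1
    rw [← garsideLeft_eq hn] at ht h2
    rw [← garsideRight_eq] at h2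
    refine degLexLT_of_cons (x := .delta) (u := (wArtin n (garsideRight n V)).toList) rfl
      (by rw [ht]; exact toList_wArtin_cons ⟨le_rfl, hn⟩ _) ?_ (by simp [AGLetter.rank])
    rw [h4, FreeMonoid.toList_mul, List.length_append, h3, wDelta, FreeMonoid.toList_of,
      List.length_singleton]
    omega
  · refine degLexLT_of_cons (x := .delta) (u := (wArtin n [n - l + 1]).toList) rfl
      (y := .a ⟨l, hl, hln⟩) (v := [.delta])
      (by rw [FreeMonoid.toList_mul, toList_wArtin_cons ⟨hl, hln⟩]; rfl) ?_
      (by simp [AGLetter.rank]; omega)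
    rw [FreeMonoid.toList_mul, FreeMonoid.toList_mul, List.length_append, List.length_append,
      length_wArtin (isWordIn_singleton hl hln), length_wArtin
      (isWordIn_singleton (by omega) (by omega)), add_comm]
    rfl
  · refine degLexLT_of_cons (x := .deltaInv) (u := (wArtin n [n - l + 1]).toList) rfl
      (y := .a ⟨l, hl, hln⟩) (v := [.deltaInv])
      (by rw [FreeMonoid.toList_mul, toList_wArtin_cons ⟨hl, hln⟩]; rfl) ?_
      (by simp [AGLetter.rank])
    rw [FreeMonoid.toList_mul, FreeMonoid.toList_mul, List.length_append, List.length_append,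
      length_wArtin (isWordIn_singleton hl hln), length_wArtin
      (isWordIn_singleton (by omega) (by omega)), add_comm]
    rfl
  · exact List.Shortlex.of_length_lt (Nat.zero_lt_succ 1)
  · exact List.Shortlex.of_length_lt (Nat.zero_lt_succ 1)

/-- Finiteness makes the order on letters well founded, which the termination argument requires. -/
instance : Finite (AGLetter n) := Finite.of_injective (β := Option (Option (Set.Icc 1 n)))
  (fun | .deltaInv => none | .delta => some none | .a i => some (some i)) (by
    rintro (_ | _ | i) (_ | _ | j) h <;> simp_all)

/-! ### Normal forms -/

/-- The power `Δ^z`, as a word. -/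
def deltaPow (n : ℕ) : ℤ → FreeMonoid (AGLetter n)
  | .ofNat p => wDelta n ^ p
  | .negSucc p => wDeltaInv n ^ (p + 1)

theorem toBraid_deltaPow (z : ℤ) : toBraid n (deltaPow n z) = garsideElement n ^ z := by
  cases z with
  | ofNat p => simp [deltaPow]
  | negSucc p => simp [deltaPow]

/-- Letters are added on the left: the conjugation rules forbid a_i before Δ or Δ⁻¹, and the inverse
rules forbid mixing Δ with Δ⁻¹. -/
theorem exists_deltaPow_mul_wArtin {w : FreeMonoid (AGLetter n)}
    (hw : IsIrreducibleWord (AGRelation n) w) :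
    ∃ z l, IsWordIn 1 n l ∧ w = deltaPow n z * wArtin n l := by
  induction w using FreeMonoid.inductionOn' with
  | one => exact ⟨0, [], isWordIn_nil _ _, rfl⟩
  | of_mul x w ih =>
    obtain ⟨z, l, hl, rfl⟩ := ih fun a u v b h hw' => hw (FreeMonoid.of x * a) u v b h (by
      rw [hw']; simp only [mul_assoc])
    have hne : ∀ u v b, AGRelation n u v → FreeMonoid.of x * (deltaPow n z * wArtin n l) ≠ u * b :=
      fun u v b h => by simpa using hw 1 u v b h
    cases x with
    | deltaInv =>
      cases z with
      | ofNat p =>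
        cases p with
        | zero => exact ⟨-1, l, hl, rfl⟩
        | succ p =>
          refine absurd ?_ (hne _ _ (wDelta n ^ p * wArtin n l) .inv_mul)
          simp only [deltaPow, pow_succ', mul_assoc, wDeltaInv]
      | negSucc p => exact ⟨.negSucc (p + 1), l, hl, by
          simp only [deltaPow, pow_succ' _ (p + 1), mul_assoc, wDeltaInv]⟩
    | delta =>
      cases z with
      | ofNat p => exact ⟨.ofNat (p + 1), l, hl, by
          simp only [deltaPow, pow_succ', mul_assoc, wDelta]⟩
      | negSucc p =>
        refine absurd ?_ (hne _ _ (wDeltaInv n ^ p * wArtin n l) .mul_inv)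
        simp only [deltaPow, pow_succ', mul_assoc, wDelta]
    | a i =>
      have hi : wArtin n [i.1] = FreeMonoid.of (AGLetter.a i) := evalWord_singleton _ i.2
      cases z with
      | ofNat p =>
        cases p with
        | zero =>
          refine ⟨0, i.1 :: l, isWordIn_cons.2 ⟨i.2, hl⟩, ?_⟩
          rw [← List.singleton_append, wArtin_append, hi]
          rfl
        | succ p =>
          refine absurd ?_ (hne _ _ (wDelta n ^ p * wArtin n l) (.delta i.1 i.2.1 i.2.2))
          simp only [deltaPow, pow_succ', mul_assoc, hi]
      | negSucc p =>
        refine absurd ?_ (hne _ _ (wDeltaInv n ^ p * wArtin n l) (.deltaInv i.1 i.2.1 i.2.2))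
        simp only [deltaPow, pow_succ', mul_assoc, hi]

theorem not_infix_of_isIrreducibleWord {x v : FreeMonoid (AGLetter n)} {l u : List ℕ}
    (hw : IsIrreducibleWord (AGRelation n) (x * wArtin n l)) (h : AGRelation n (wArtin n u) v) :
    ¬ u <:+: l := by
  rintro ⟨a, b, rfl⟩
  exact hw (x * wArtin n a) _ _ (wArtin n b) h (by simp only [wArtin_append, mul_assoc])

theorem commFree_of_isIrreducibleWord {x : FreeMonoid (AGLetter n)} {l : List ℕ}
    (hl : IsWordIn 1 n l) (hw : IsIrreducibleWord (AGRelation n) (x * wArtin n l)) :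
    CommFree l := fun s m hsm hi =>
  not_infix_of_isIrreducibleWord hw
    (.comm s m (hl m (hi.subset (by simp))).1 (hl s (hi.subset (by simp))).2 hsm) hi

theorem lexMin_of_isIrreducibleWord {x : FreeMonoid (AGLetter n)} {l : List ℕ}
    (hl : IsWordIn 1 n l) (hw : IsIrreducibleWord (AGRelation n) (x * wArtin n l)) : LexMin l :=
  lexMin_of_braidFree hl (commFree_of_isIrreducibleWord hl hw)
    fun i j V W hi hj hji hV hW hWi h => not_infix_of_isIrreducibleWord hw
      (.braid i j V W hi (hl _ (h.subset (by simp))).2 hj hji hV hW hWi) h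

theorem not_delta_dvd {x : FreeMonoid (AGLetter n)} {l : List ℕ} (hn : 1 ≤ n)
    (hl : IsWordIn 1 n l) (hw : IsIrreducibleWord (AGRelation n) (x * wArtin n l)) :
    ¬ PosBraid.delta n ∣ word l := fun hd => by
  obtain ⟨V, t, hV, ht⟩ := exists_garsideLeft_append hn (lexMin_of_isIrreducibleWord hl hw)
    (commFree_of_isIrreducibleWord hl hw) (fun m hm => (hl m hm).1) hd
  exact not_infix_of_isIrreducibleWord hw (.garside V hV) ⟨[], t, by simp [ht]⟩

theorem deltaPow_unique {z z' : ℤ} {l l' : List ℕ} (hn : 1 ≤ n) (hl : IsWordIn 1 n l)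
    (hl' : IsWordIn 1 n l') (hw : IsIrreducibleWord (AGRelation n) (deltaPow n z * wArtin n l))
    (hw' : IsIrreducibleWord (AGRelation n) (deltaPow n z' * wArtin n l'))
    (h : toBraid n (deltaPow n z * wArtin n l) = toBraid n (deltaPow n z' * wArtin n l'))
    (hz : z ≤ z') : z = z' ∧ l = l' := by
  obtain ⟨p, rfl⟩ := Int.le.dest hz
  rw [map_mul, map_mul, toBraid_deltaPow, toBraid_deltaPow, zpow_add, mul_assoc,
    mul_left_cancel_iff, zpow_natCast, toBraid_wArtin, toBraid_wArtin] at h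
  obtain ⟨d, hd, hdp⟩ := exists_word_eq_delta_pow n p
  have hE : evalWord (artinGen n) d = garsideElement n ^ p := by
    clear h hw hw' hz
    induction p generalizing d with
    | zero =>
      rw [evalWord_artinGen_eq hd (by simpa using hdp : word d = word []), pow_zero]
      rfl
    | succ p ih =>
      obtain ⟨e, he, hep⟩ := exists_word_eq_delta_pow n p
      rw [pow_succ, ← ih e he hep, garsideElement, ← evalWord_append]
      exact evalWord_artinGen_eq hd (by rw [hdp, word_append, hep, pow_succ, PosBraid.delta])
  rw [← hE, ← evalWord_append, evalWord_artinGen_eq_iff hl (isWordIn_append.2 ⟨hd, hl'⟩),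
    word_append, hdp] at h
  cases p with
  | zero =>
    refine ⟨by simp, (lexMin_of_isIrreducibleWord hl hw).eq_of_word_eq
      (lexMin_of_isIrreducibleWord hl' hw') (by simpa using h)⟩
  | succ p =>
    -- A positive power of Δ would make Δ divide l, which the Garside rule excludes.
    rw [pow_succ', mul_assoc] at h
    exact absurd ⟨_, h⟩ (not_delta_dvd hn hl hw)

/-- Distinct irreducible words denote distinct elements of the braid group. -/
theorem eq_of_toBraid_eq (hn : 1 ≤ n) {w w' : FreeMonoid (AGLetter n)}
    (hw : IsIrreducibleWord (AGRelation n) w) (hw' : IsIrreducibleWord (AGRelation n) w')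
    (h : toBraid n w = toBraid n w') : w = w' := by
  obtain ⟨z, l, hl, rfl⟩ := exists_deltaPow_mul_wArtin hw
  obtain ⟨z', l', hl', rfl⟩ := exists_deltaPow_mul_wArtin hw'
  rcases le_total z z' with hz | hz
  · obtain ⟨rfl, rfl⟩ := deltaPow_unique hn hl hl' hw hw' h hz
    rfl
  · obtain ⟨rfl, rfl⟩ := deltaPow_unique hn hl' hl hw' hw h.symm hz
    rfl

/-! ### The isomorphism with the braid group -/

theorem toBraid_surjective (n : ℕ) : Function.Surjective (toBraid n) := by
  -- The range is a priori only a submonoid, so the induction carries inverses along.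
  suffices h : ∀ x : BraidGroup n, (∃ w, toBraid n w = x) ∧ ∃ w, toBraid n w = x⁻¹ from
    fun x => (h x).1
  intro x
  have hx : x ∈ Subgroup.closure
      (Set.range (PresentedGroup.of (rels := {r | BraidRelator n r}))) := by
    rw [PresentedGroup.closure_range_of]
    trivial
  induction hx using Subgroup.closure_induction with
  | mem x hx =>
    obtain ⟨i, rfl⟩ := hx
    refine ⟨⟨.of (.a i), rfl⟩, ?_⟩
    obtain ⟨m, hm, h⟩ := exists_σ_mul_eq_delta i.2.1 i.2.2
    have h' := evalWord_artinGen_eq (n := n) (l := [i.1] ++ m) (l' := garsideWord n)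
      (isWordIn_append.2 ⟨isWordIn_singleton i.2.1 i.2.2, hm⟩) (by simpa [PosBraid.delta] using h)
    rw [evalWord_append, evalWord_singleton _ i.2] at h'
    refine ⟨wArtin n m * wDeltaInv n, ?_⟩
    rw [map_mul, toBraid_wArtin, toBraid_wDeltaInv, garsideElement, ← h', mul_inv_rev,
      mul_inv_cancel_left]
    rfl
  | one => exact ⟨⟨1, map_one _⟩, 1, by simp⟩
  | mul x y _ _ hx hy =>
    obtain ⟨⟨u, rfl⟩, u', hu'⟩ := hx
    obtain ⟨⟨v, rfl⟩, v', hv'⟩ := hy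
    exact ⟨⟨u * v, map_mul _ _ _⟩, v' * u', by rw [map_mul, hu', hv', mul_inv_rev]⟩
  | inv x _ hx => exact ⟨hx.2, by simpa using hx.1⟩

/-- The homomorphism from the monoid presented by the rewriting system to the braid group. -/
def presentedToBraid (hn : 1 ≤ n) : PresentedMonoid (AGRelation n) →* BraidGroup n :=
  PresentedMonoid.lift AGLetter.toBraid fun _ _ h => toBraid_eq hn h

theorem presentedToBraid_mk (hn : 1 ≤ n) (w : FreeMonoid (AGLetter n)) :
    presentedToBraid hn (PresentedMonoid.mk _ w) = toBraid n w := rfl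

theorem presentedToBraid_bijective (hn : 1 ≤ n) : Function.Bijective (presentedToBraid hn) := by
  refine ⟨fun x y h => ?_, fun x => ?_⟩
  · obtain ⟨u, rfl⟩ := PresentedMonoid.surjective_mk x
    obtain ⟨v, rfl⟩ := PresentedMonoid.surjective_mk y
    rw [presentedToBraid_mk, presentedToBraid_mk] at h
    have hR := fun u v (h : AGRelation n u v) => degLexLT hn h
    have hf := fun u v (h : AGRelation n u v) => toBraid_eq hn h
    have hm := fun u v (h : AGRelation n u v) => PresentedMonoid.mk_eq_mk_of_rel h
    obtain ⟨u', hu, hu'⟩ := exists_isIrreducibleWord hR u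
    obtain ⟨v', hv, hv'⟩ := exists_isIrreducibleWord hR v
    rw [map_eq_of_rewrite _ hm hu, map_eq_of_rewrite _ hm hv, eq_of_toBraid_eq hn hu' hv' (by
      rw [← map_eq_of_rewrite _ hf hu, ← map_eq_of_rewrite _ hf hv, h])]
  · obtain ⟨w, rfl⟩ := toBraid_surjective n x
    exact ⟨PresentedMonoid.mk _ w, rfl⟩

end ArtinGarside

theorem theorem1p1 (n : ℕ) (hn : 1 ≤ n) :
    (∃ e : PresentedMonoid (AGRelation n) ≃* BraidGroup n,
      ∀ x : AGLetter n, e (PresentedMonoid.of (AGRelation n) x) = x.toBraid) ∧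
    ∀ (k : Type*) [Field k], IsGroebnerShirshov (relationPolynomials k (AGRelation n)) := by
  refine ⟨⟨MulEquiv.ofBijective _ (ArtinGarside.presentedToBraid_bijective hn), fun _ => rfl⟩, ?_⟩
  intro k _
  exact isGroebnerShirshov_relationPolynomials (fun _ _ => ArtinGarside.degLexLT hn)
    (ArtinGarside.toBraid n) (fun _ _ => ArtinGarside.toBraid_eq hn)
    fun _ _ => ArtinGarside.eq_of_toBraid_eq hn
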